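/- Let $M$ be a smooth manifold (without boundary) of odd dimension $2n+1$, equipped with a smooth $1$-form $\vartheta$ and a smooth $2$-form $\omega$ such that $\vartheta\wedge(d\vartheta+\omega)^n\neq 0$ everywhere on $M$ (a twisted contact manifold). For a bivector field $\Lambda$ let $\Lambda^\#:T^*M\to TM$ be the morphism with $\langle\beta,\Lambda^\#(\alpha)\rangle=\Lambda(\alpha,\beta)$. Then there are a unique vector field $E$ and a unique bivector field $\Lambda$ on $M$ such that $$i(E)\vartheta=1,\qquad i(E)(d\vartheta+\omega)=0,$$ $$\Lambda^\#(\vartheta)=0,\qquad i(\Lambda^\#(\alpha))(d\vartheta+\omega)=-(\alpha-\langle\alpha,E\rangle\,\vartheta)\quad\text{for all covectors }\alpha ;$$ both are smooth, and $((\Lambda,E),\omega)$ satisfies the twisted Jacobi equations $$[\Lambda,\Lambda]+2E\wedge\Lambda=2\Lambda^\#(d\omega)+2(\Lambda^\#\omega)\wedge E,$$ $$[E,\Lambda]=(\Lambda^\#\otimes 1)(d\omega)(E)-\big((\Lambda^\#\otimes 1)(\omega)(E)\big)\wedge E .$$ Here $[\cdot,\cdot]$ is the Schouten bracket, normalised by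 $[X_1\wedge\dots\wedge X_p,Y_1\wedge\dots\wedge Y_q]=\sum_{i,j}(-1)^{i+j}[X_i,Y_j]\wedge X_1\wedge\cdots\widehat{X_i}\cdots\wedge X_p\wedge Y_1\wedge\cdots\widehat{Y_j}\cdots\wedge Y_q$, and for a $k$-form $\eta$, $\Lambda^\#(\eta)(\alpha_1,\dots,\alpha_k)=(-1)^k\eta(\Lambda^\#\alpha_1,\dots,\Lambda^\#\alpha_k)$ and $(\Lambda^\#\otimes 1)(\eta)(X)(\alpha_1,\dots,\alpha_{k-1})=(-1)^k\eta(\Lambda^\#\alpha_1,\dots,\Lambda^\#\alpha_{k-1},X)$. Moreover $((\Lambda,E),\omega)$ is a twisted Jacobi structure on $M$, that is, $$\tfrac12[(\Lambda,E),(\Lambda,E)]^{(0,1)}=(\Lambda,E)^\#(d\omega,\omega).$$ Here $(\Lambda,E)$ is the section of $\bigwedge^2(TM\times\mathbb R)$ given by $(\Lambda,E)((\alpha,f),(\beta,g))=\Lambda(\alpha,\beta)+f\langle\beta,E\rangle-g\langle\alpha,E\rangle$; the morphism $(\Lambda,E)^\#:T^*M\times\mathbb R\to TM\times\mathbb R$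 is $(\Lambda,E)^\#(\alpha,f)=(\Lambda^\#(\alpha)+fE,-\langle\alpha,E\rangle)$, extended to sections $\zeta$ of $\bigwedge^3(T^*M\times\mathbb R)$ by $(\Lambda,E)^\#(\zeta)(a_1,a_2,a_3)=-\zeta((\Lambda,E)^\#a_1,(\Lambda,E)^\#a_2,(\Lambda,E)^\#a_3)$; the section $(d\omega,\omega)$ of $\bigwedge^3(T^*M\times\mathbb R)$ is $$(d\omega,\omega)((X_1,f_1),(X_2,f_2),(X_3,f_3))=d\omega(X_1,X_2,X_3)+f_1\,\omega(X_2,X_3)+f_2\,\omega(X_3,X_1)+f_3\,\omega(X_1,X_2);$$ and $[\cdot,\cdot]^{(0,1)}$ is the Schouten bracket $[\cdot,\cdot]$ (same normalisation) of the Lie algebroid $TM\times\mathbb R$ with bracket $[(X,f),(Y,g)]=([X,Y],X(g)-Y(f))$ and anchor the first projection, modified by the $1$-cocycle $\phi=(0,1)$: for $P$ of degree $p$ and $Q$ of degree $q$, $[P,Q]^\phi=[P,Q]+(p-1)\,P\wedge i_\phi Q+(-1)^p(q-1)\,i_\phi P\wedge Q$. -/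

import Mathlib

open scoped Manifold

noncomputable section

namespace TwistedJacobi

section PointwiseAlgebra

variable {W : Type*} [AddCommGroup W] [Module ℝ W] [TopologicalSpace W]

/-- Alternating `k`-forms on `W`, that is `⋀ᵏ W*`. -/
abbrev Form (k : ℕ) (W : Type*) [AddCommGroup W] [Module ℝ W] [TopologicalSpace W] : Type _ :=
  W [⋀^Fin k]→L[ℝ] ℝ

/-- `k`-vectors on the finite-dimensional space `W`, that is `⋀ᵏ W`, realised as the alternating
`k`-forms on the dual of `W`: a `k`-vector is evaluated on `k` covectors. -/
abbrev MultiVec (k : ℕ) (W : Type*) [AddCommGroup W] [Module ℝ W] [TopologicalSpace W] : Type _ :=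
  (W →L[ℝ] ℝ) [⋀^Fin k]→L[ℝ] ℝ

/-- The tensor product `(v₁, …, v_{p+q}) ↦ α(v₁, …, v_p) β(v_{p+1}, …, v_{p+q})`. -/
def tensor {p q : ℕ} (α : Form p W) (β : Form q W) :
    ContinuousMultilinearMap ℝ (fun _ : Fin (p + q) => W) ℝ where
  toMultilinearMap := ((LinearMap.mul' ℝ ℝ).compMultilinearMap
    (α.toMultilinearMap.domCoprod β.toMultilinearMap)).domDomCongr finSumFinEquiv
  cont := by
    change Continuous fun v : Fin (p + q) → W =>
      α (fun i => v (Fin.castAdd q i)) * β (fun j => v (Fin.natAdd p j))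
    refine (α.cont.comp ?_).mul (β.cont.comp ?_) <;>
    exact continuous_pi fun _ => continuous_apply _

theorem tensor_apply {p q : ℕ} (α : Form p W) (β : Form q W) (v : Fin (p + q) → W) :
    tensor α β v = α (fun i => v (Fin.castAdd q i)) * β (fun j => v (Fin.natAdd p j)) := rfl

/-- The wedge product, with the determinant normalisation
`(α ∧ β)(v) = (p! q!)⁻¹ ∑_σ sign(σ) α(v_{σ(1)}, …, v_{σ(p)}) β(v_{σ(p+1)}, …, v_{σ(p+q)})`.
It serves for forms on `W` and, applied to the dual of `W`, for multivectors. -/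
def wedge {p q : ℕ} (α : Form p W) (β : Form q W) : Form (p + q) W :=
  ((p.factorial * q.factorial : ℕ) : ℝ)⁻¹ •
    ContinuousMultilinearMap.alternatization (tensor α β)

/-- The powers `Φ ∧ ⋯ ∧ Φ` (`n` factors) of a 2-form. -/
def wedgePow (Φ : Form 2 W) : (n : ℕ) → Form (2 * n) W
  | 0 => ContinuousAlternatingMap.constOfIsEmpty ℝ W (Fin 0) (1 : ℝ)
  | n + 1 => wedge (wedgePow Φ n) Φ

/-- The reindexing `v ↦ η(v ∘ σ)`. -/
def reindex {k l : ℕ} (σ : Fin k ≃ Fin l) (η : Form k W) : Form l W where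
  toFun v := η (fun i => v (σ i))
  map_update_add' := (η.toAlternatingMap.domDomCongr σ).map_update_add'
  map_update_smul' := (η.toAlternatingMap.domDomCongr σ).map_update_smul'
  map_eq_zero_of_eq' := (η.toAlternatingMap.domDomCongr σ).map_eq_zero_of_eq'
  cont := η.cont.comp (continuous_pi fun _ => continuous_apply _)

/-- The same form, with its degree rewritten along an equality of natural numbers. -/
def castDeg {k l : ℕ} (h : k = l) (η : Form k W) : Form l W :=
  reindex (finCongr h) η

/-- Interior product `i(w)η = η(w, ·, …, ·)`. -/
def intProd {k : ℕ} (w : W) (η : Form (k + 1) W) : Form k W where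
  toFun v := η (Matrix.vecCons w v)
  map_update_add' := (η.toAlternatingMap.curryLeft w).map_update_add'
  map_update_smul' := (η.toAlternatingMap.curryLeft w).map_update_smul'
  map_eq_zero_of_eq' := (η.toAlternatingMap.curryLeft w).map_eq_zero_of_eq'
  cont := η.cont.comp (continuous_const.matrixVecCons continuous_id)

/-- The contraction `η(·, …, ·, w)` in the last argument, see `intProdLast_apply`. -/
def intProdLast {k : ℕ} (w : W) (η : Form (k + 1) W) : Form k W :=
  intProd w (reindex (finRotate (k + 1)) η)

theorem intProdLast_apply {k : ℕ} (w : W) (η : Form (k + 1) W) (v : Fin k → W) :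
    intProdLast w η v = η (Fin.snoc v w : Fin (k + 1) → W) := by
  change η (fun i => (Matrix.vecCons w v) (finRotate (k + 1) i)) = _
  congr 1
  funext i
  refine Fin.lastCases ?_ (fun j => ?_) i
  · simp
  · rw [Fin.snoc_castSucc, finRotate_apply, Fin.coeSucc_eq_succ]
    rfl

/-- For `S : W* → W`, the extension of `S` to `k`-forms,
`S(η)(α₁, …, α_k) = (-1)ᵏ η(S α₁, …, S α_k)`. -/
def sharpForm {k : ℕ} (S : (W →L[ℝ] ℝ) →L[ℝ] W) (η : Form k W) : MultiVec k W :=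
  (-1 : ℝ) ^ k • η.compContinuousLinearMap S

/-- For `S : W* → W`, the `k`-vector
`(S ⊗ 1)(η)(α₁, …, α_k)(w) = (-1)ᵏ⁺¹ η(S α₁, …, S α_k, w)` obtained from a `(k+1)`-form `η`. -/
def sharpTensorOne {k : ℕ} (S : (W →L[ℝ] ℝ) →L[ℝ] W) (η : Form (k + 1) W) (w : W) :
    MultiVec k W :=
  (-1 : ℝ) ^ (k + 1) • (intProdLast w η).compContinuousLinearMap S

variable {W' : Type*} [AddCommGroup W'] [Module ℝ W'] [TopologicalSpace W']

/-- The push-forward `L_* P` of a `k`-vector by a linear map: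
`(L_* P)(α₁, …, α_k) = P(α₁ ∘ L, …, α_k ∘ L)`. -/
def push {k : ℕ} (L : W →L[ℝ] W') (P : MultiVec k W) : MultiVec k W' :=
  P.compContinuousLinearMap (L.precomp ℝ)

theorem push_apply {k : ℕ} (L : W →L[ℝ] W') (P : MultiVec k W) (α : Fin k → (W' →L[ℝ] ℝ)) :
    push L P α = P (fun i => (α i).comp L) := rfl

variable [ContinuousSMul ℝ W]

/-- A vector regarded as a 1-vector: `α ↦ ⟨α, w⟩`. -/
def vec (w : W) : MultiVec 1 W :=
  ContinuousAlternatingMap.ofSubsingleton ℝ (W →L[ℝ] ℝ) ℝ (0 : Fin 1)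
    { toFun := fun α => α w
      map_add' := fun _ _ => rfl
      map_smul' := fun _ _ => rfl
      cont := continuous_eval_const w }

theorem vec_apply (w : W) (α : Fin 1 → (W →L[ℝ] ℝ)) : vec w α = α 0 w := rfl

variable [IsTopologicalAddGroup W] [T2Space W] [FiniteDimensional ℝ W]

/-- The morphism `P^# : W* → W` of a bivector `P`, given by `⟨β, P^#(α)⟩ = P(α, β)`,
see `apply_sharp`. It is written in a basis `(eᵢ)` as `P^#(α) = ∑ᵢ P(α, eⁱ) eᵢ`. -/
def sharp (P : MultiVec 2 W) : (W →L[ℝ] ℝ) →L[ℝ] W :=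
  ∑ i, (P.toContinuousLinearMap
      ![0, LinearMap.toContinuousLinearMap ((Module.finBasis ℝ W).coord i)] 0).smulRight
    (Module.finBasis ℝ W i)

theorem apply_sharp (P : MultiVec 2 W) (α β : W →L[ℝ] ℝ) : β (sharp P α) = P ![α, β] := by
  have hβ : β = ∑ i, β (Module.finBasis ℝ W i) •
      LinearMap.toContinuousLinearMap ((Module.finBasis ℝ W).coord i) := by
    ext w
    conv_lhs => rw [← (Module.finBasis ℝ W).sum_repr w]
    rw [map_sum, sum_apply]
    refine Finset.sum_congr rfl fun i _ => ?_
    rw [map_smul]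
    exact mul_comm _ _
  have hlin : P ![α, β] = P.toContinuousLinearMap ![α, 0] 1 β := by
    change _ = P (Function.update ![α, 0] 1 β)
    congr 1
    funext i; fin_cases i <;> simp
  rw [hlin]
  conv_rhs => rw [hβ]
  rw [map_sum]
  have hs : sharp P α = ∑ i, P ![α, LinearMap.toContinuousLinearMap
      ((Module.finBasis ℝ W).coord i)] • Module.finBasis ℝ W i := by
    rw [sharp, sum_apply]
    refine Finset.sum_congr rfl fun i _ => ?_
    change P (Function.update (![0, LinearMap.toContinuousLinearMap
      ((Module.finBasis ℝ W).coord i)] : Fin 2 → (W →L[ℝ] ℝ)) 0 α) •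
        Module.finBasis ℝ W i = _
    congr 2
    funext j; fin_cases j <;> simp
  rw [hs, map_sum]
  refine Finset.sum_congr rfl fun i _ => ?_
  rw [map_smul, map_smul, smul_eq_mul, smul_eq_mul, mul_comm]
  congr 1
  change _ = P (Function.update _ 1 _)
  congr 1
  funext j; fin_cases j <;> simp

end PointwiseAlgebra

section Flat

variable {V : Type*} [NormedAddCommGroup V] [NormedSpace ℝ V] [FiniteDimensional ℝ V]
variable {A : Type*} [NormedAddCommGroup A] [NormedSpace ℝ A]

/-- The Schouten bracket, on the vector space `V`, of the multivector fields of degree `p + 1` and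
`q + 1` of the trivial Lie algebroid `V × A → V` with linear anchor `ρ : A → V`, in which constant
sections commute:
`[P, Q] = (-1)ᵖ ∑ᵢ i(ρ*eⁱ)P ∧ ∂ᵢQ - (-1)^{pq} (-1)^q ∑ᵢ i(ρ*eⁱ)Q ∧ ∂ᵢP`.
It is the graded extension of the bracket of sections such that
`[X₁ ∧ ⋯, Y₁ ∧ ⋯] = ∑ (-1)^{i+j} [Xᵢ, Yⱼ] ∧ X₁ ∧ ⋯ X̂ᵢ ⋯ ∧ Y₁ ∧ ⋯ Ŷⱼ ⋯`. -/
def schoutenFlat (ρ : A →L[ℝ] V) {p q : ℕ} (P : V → MultiVec (p + 1) A)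
    (Q : V → MultiVec (q + 1) A) (y : V) : MultiVec (p + q + 1) A :=
  let b := Module.finBasis ℝ V
  let e : Fin (Module.finrank ℝ V) → (A →L[ℝ] ℝ) :=
    fun i => (LinearMap.toContinuousLinearMap (b.coord i)).comp ρ
  (-1 : ℝ) ^ p • castDeg (by omega)
      (∑ i, wedge (intProd (e i) (P y)) (fderiv ℝ Q y (b i)))
    - (-1 : ℝ) ^ (p * q + q) • castDeg (by omega)
      (∑ i, wedge (intProd (e i) (Q y)) (fderiv ℝ P y (b i)))

end Flat

section Manifold

variable (V : Type*) [NormedAddCommGroup V] [NormedSpace ℝ V]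
variable {M : Type*} [TopologicalSpace M] [ChartedSpace V M]

/-- The tangent space at `x` of a manifold without boundary modelled on `V`. -/
abbrev T (x : M) : Type _ := TangentSpace 𝓘(ℝ, V) x

instance (x : M) : T2Space (T V x) := inferInstanceAs (T2Space V)

instance [FiniteDimensional ℝ V] (x : M) : FiniteDimensional ℝ (T V x) :=
  inferInstanceAs (FiniteDimensional ℝ V)

/-- The differential at `x` of the preferred chart at `x₀`. -/
def dChart (x₀ x : M) : T V x →L[ℝ] V :=
  mfderiv 𝓘(ℝ, V) 𝓘(ℝ, V) (extChartAt 𝓘(ℝ, V) x₀) x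

/-- The inverse of the differential at `x` of the preferred chart at `x₀`. -/
def dChartInv (x₀ x : M) : V →L[ℝ] T V x :=
  (dChart V x₀ x).inverse

variable (M) in
/-- Vector fields on `M`. -/
abbrev VecField : Type _ := ∀ x : M, T V x

variable (M) in
/-- Differential forms of degree `k` on `M`. -/
abbrev DiffForm (k : ℕ) : Type _ := ∀ x : M, Form k (T V x)

variable (M) in
/-- Multivector fields of degree `k` on `M`, i.e. sections of `⋀ᵏ TM`. -/
abbrev MultiVecField (k : ℕ) : Type _ := ∀ x : M, MultiVec k (T V x)

variable (M) in
/-- Sections of `⋀ᵏ (TM × ℝ)`. -/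
abbrev MultiVecFieldR (k : ℕ) : Type _ := ∀ x : M, MultiVec k (T V x × ℝ)

variable {V}

/-- The expression of a form in the preferred chart at `x₀`. -/
def formInChart {k : ℕ} (η : DiffForm V M k) (x₀ : M) (y : V) : Form k V :=
  (η ((extChartAt 𝓘(ℝ, V) x₀).symm y)).compContinuousLinearMap
    (dChartInv V x₀ ((extChartAt 𝓘(ℝ, V) x₀).symm y))

/-- The expression of a multivector field in the preferred chart at `x₀`. -/
def multiVecInChart {k : ℕ} (P : MultiVecField V M k) (x₀ : M) (y : V) : MultiVec k V :=
  push (dChart V x₀ ((extChartAt 𝓘(ℝ, V) x₀).symm y)) (P ((extChartAt 𝓘(ℝ, V) x₀).symm y))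

/-- The expression of a section of `⋀ᵏ (TM × ℝ)` in the preferred chart at `x₀`. -/
def multiVecRInChart {k : ℕ} (P : MultiVecFieldR V M k) (x₀ : M) (y : V) : MultiVec k (V × ℝ) :=
  push ((dChart V x₀ ((extChartAt 𝓘(ℝ, V) x₀).symm y)).prodMap (ContinuousLinearMap.id ℝ ℝ))
    (P ((extChartAt 𝓘(ℝ, V) x₀).symm y))

/-- Smooth vector fields. -/
def SmoothVecField [IsManifold 𝓘(ℝ, V) (⊤ : ℕ∞) M] (X : VecField V M) : Prop :=
  ContMDiff 𝓘(ℝ, V) 𝓘(ℝ, V).tangent (⊤ : ℕ∞) (fun x => (⟨x, X x⟩ : TangentBundle 𝓘(ℝ, V) M))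

/-- Smooth differential forms: the expressions in the charts are smooth. -/
def SmoothForm {k : ℕ} (η : DiffForm V M k) : Prop :=
  ∀ x₀ : M, ContDiffOn ℝ (⊤ : ℕ∞) (formInChart η x₀) (extChartAt 𝓘(ℝ, V) x₀).target

/-- Smooth multivector fields: the expressions in the charts are smooth. -/
def SmoothMultiVecField {k : ℕ} (P : MultiVecField V M k) : Prop :=
  ∀ x₀ : M, ContDiffOn ℝ (⊤ : ℕ∞) (multiVecInChart P x₀) (extChartAt 𝓘(ℝ, V) x₀).target

/-- The exterior derivative on `M`, computed at `x` in the preferred chart at `x`. -/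
def extDer {k : ℕ} (η : DiffForm V M k) : DiffForm V M (k + 1) := fun x =>
  (extDeriv (formInChart η x) (extChartAt 𝓘(ℝ, V) x x)).compContinuousLinearMap (dChart V x x)

variable [FiniteDimensional ℝ V]

/-- The Schouten bracket of multivector fields on `M`, computed at `x` in the preferred chart
at `x`. -/
def schouten {p q : ℕ} (P : MultiVecField V M (p + 1)) (Q : MultiVecField V M (q + 1)) :
    MultiVecField V M (p + q + 1) := fun x =>
  push (dChartInv V x x) (schoutenFlat (ContinuousLinearMap.id ℝ V)
    (multiVecInChart P x) (multiVecInChart Q x) (extChartAt 𝓘(ℝ, V) x x))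

/-- The Schouten bracket of the Lie algebroid `TM × ℝ`, whose anchor is the first projection and
whose bracket is `[(X, f), (Y, g)] = ([X, Y], X(g) - Y(f))`, computed at `x` in the preferred
chart at `x`. -/
def schoutenR {p q : ℕ} (P : MultiVecFieldR V M (p + 1)) (Q : MultiVecFieldR V M (q + 1)) :
    MultiVecFieldR V M (p + q + 1) := fun x =>
  push ((dChartInv V x x).prodMap (ContinuousLinearMap.id ℝ ℝ))
    (schoutenFlat (ContinuousLinearMap.fst ℝ V ℝ)
      (multiVecRInChart P x) (multiVecRInChart Q x) (extChartAt 𝓘(ℝ, V) x x))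

/-- The Schouten bracket of `TM × ℝ` modified by the 1-cocycle `φ = (0, 1)`:
`[P, Q]^φ = [P, Q] + (deg P - 1) P ∧ i(φ)Q + (-1)^{deg P} (deg Q - 1) i(φ)P ∧ Q`. -/
def schoutenMod {p q : ℕ} (P : MultiVecFieldR V M (p + 1)) (Q : MultiVecFieldR V M (q + 1)) :
    MultiVecFieldR V M (p + q + 1) := fun x =>
  schoutenR P Q x
    + (p : ℝ) • castDeg (by omega)
        (wedge (P x) (intProd (ContinuousLinearMap.snd ℝ (T V x) ℝ) (Q x)))
    + ((-1 : ℝ) ^ (p + 1) * (q : ℝ)) • castDeg (by omega)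
        (wedge (intProd (ContinuousLinearMap.snd ℝ (T V x) ℝ) (P x)) (Q x))

/-- The section of `⋀² (TM × ℝ)` determined by a bivector field and a vector field, that is
`Λ + (0, 1) ∧ E`, or `(Λ, E)((α, f), (β, g)) = Λ(α, β) + f ⟨β, E⟩ - g ⟨α, E⟩`. -/
def pair (L : MultiVecField V M 2) (E : VecField V M) : MultiVecFieldR V M 2 := fun x =>
  push (ContinuousLinearMap.inl ℝ (T V x) ℝ) (L x)
    + wedge (vec ((0, 1) : T V x × ℝ)) (vec ((E x, 0) : T V x × ℝ))

/-- The section of `⋀ᵏ⁺¹ (T*M × ℝ)` determined by a `(k+1)`-form `η` and a `k`-form `ξ`, here for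
`k = 2`:
`(η, ξ)((X₁, f₁), (X₂, f₂), (X₃, f₃)) = η(X₁, X₂, X₃) + f₁ ξ(X₂, X₃) + f₂ ξ(X₃, X₁) + f₃ ξ(X₁, X₂)`. -/
def pairForm (η : DiffForm V M 3) (ξ : DiffForm V M 2) (x : M) : Form 3 (T V x × ℝ) :=
  (η x).compContinuousLinearMap (ContinuousLinearMap.fst ℝ (T V x) ℝ)
    + wedge (p := 1) (q := 2)
        (ContinuousAlternatingMap.ofSubsingleton ℝ (T V x × ℝ) ℝ (0 : Fin 1)
          (ContinuousLinearMap.snd ℝ (T V x) ℝ))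
        ((ξ x).compContinuousLinearMap (ContinuousLinearMap.fst ℝ (T V x) ℝ))

/-- The morphism `(Λ, E)^# : T*M × ℝ → TM × ℝ`,
`(Λ, E)^#(α, f) = (Λ^#(α) + f E, -⟨α, E⟩)`. A covector `ζ` of `T_x M × ℝ` is `(α, f)` with
`α = ζ(·, 0)` and `f = ζ(0, 1)`. -/
def pairSharp (L : MultiVecField V M 2) (E : VecField V M) (x : M) :
    (T V x × ℝ →L[ℝ] ℝ) →L[ℝ] T V x × ℝ where
  toFun ζ := (sharp (L x) (ζ.comp (ContinuousLinearMap.inl ℝ (T V x) ℝ)) + ζ (0, 1) • E x,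
    -ζ (E x, 0))
  map_add' ζ ζ' := by
    ext
    · simp [add_smul]; abel
    · simp; ring
  map_smul' c ζ := by
    ext <;> simp [mul_smul]
  cont := by
    refine Continuous.prodMk (Continuous.add ?_ ?_) ?_
    · exact (sharp (L x)).continuous.comp
        ((ContinuousLinearMap.inl ℝ (T V x) ℝ).precomp ℝ).continuous
    · exact (continuous_eval_const _).smul continuous_const
    · exact (continuous_eval_const _).neg

/-- Twisted Jacobi structures `((Λ, E), ω)` on `M`:
`½ [(Λ, E), (Λ, E)]^{(0,1)} = (Λ, E)^#(dω, ω)`. -/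
structure IsTwistedJacobi [IsManifold 𝓘(ℝ, V) (⊤ : ℕ∞) M] (L : MultiVecField V M 2)
    (E : VecField V M) (ω : DiffForm V M 2) : Prop where
  smooth_bivector : SmoothMultiVecField L
  smooth_vector : SmoothVecField E
  smooth_form : SmoothForm ω
  equation : ∀ x : M, (2⁻¹ : ℝ) • (schoutenMod (pair L E) (pair L E) x : MultiVec 3 (T V x × ℝ))
    = sharpForm (pairSharp L E x) (pairForm (extDer ω) ω x)

/-- `[Λ, Λ] + 2 E ∧ Λ = 2 Λ^#(dω) + 2 (Λ^# ω) ∧ E`. -/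
def TwistedJacobiEq₁ (L : MultiVecField V M 2) (E : VecField V M) (ω : DiffForm V M 2) : Prop :=
  ∀ x : M, (schouten L L x : MultiVec 3 (T V x))
      + (2 : ℝ) • (wedge (vec (E x)) (L x) : MultiVec 3 (T V x))
    = (2 : ℝ) • (sharpForm (sharp (L x)) (extDer ω x) : MultiVec 3 (T V x))
      + (2 : ℝ) • (wedge (sharpForm (sharp (L x)) (ω x)) (vec (E x)) : MultiVec 3 (T V x))

/-- `[E, Λ] = (Λ^# ⊗ 1)(dω)(E) - ((Λ^# ⊗ 1)(ω)(E)) ∧ E`. -/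
def TwistedJacobiEq₂ (L : MultiVecField V M 2) (E : VecField V M) (ω : DiffForm V M 2) : Prop :=
  ∀ x : M, (schouten (p := 0) (q := 1) (fun z => vec (E z)) L x : MultiVec 2 (T V x))
    = (sharpTensorOne (sharp (L x)) (extDer ω x) (E x) : MultiVec 2 (T V x))
      - (wedge (sharpTensorOne (sharp (L x)) (ω x) (E x)) (vec (E x)) : MultiVec 2 (T V x))

/-- Twisted contact structures `(ϑ, ω)` on a manifold of dimension `2n + 1`: a smooth 1-form and a
smooth 2-form such that `ϑ ∧ (dϑ + ω)ⁿ` vanishes nowhere. -/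
structure IsTwistedContact (n : ℕ) (ϑ : DiffForm V M 1) (ω : DiffForm V M 2) : Prop where
  finrank_eq : Module.finrank ℝ V = 2 * n + 1
  smooth_one : SmoothForm ϑ
  smooth_two : SmoothForm ω
  nonvanishing : ∀ x : M, wedge (ϑ x) (wedgePow (extDer ϑ x + ω x) n) ≠ 0

/-- The conditions `i(E)ϑ = 1`, `i(E)(dϑ + ω) = 0`, `Λ^#(ϑ) = 0` and
`i(Λ^#(α))(dϑ + ω) = -(α - ⟨α, E⟩ ϑ)` for all covectors `α`. Forms of degree 1 are compared with
covectors by evaluation on tangent vectors. -/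
structure IsAssociatedPair (ϑ : DiffForm V M 1) (ω : DiffForm V M 2)
    (L : MultiVecField V M 2) (E : VecField V M) : Prop where
  reeb_one : ∀ x : M, ϑ x ![E x] = 1
  reeb_two : ∀ x : M, intProd (E x) (extDer ϑ x + ω x) = 0
  sharp_one : ∀ x : M, sharp (L x) ((ϑ x).toContinuousLinearMap 0 0) = 0
  sharp_two : ∀ (x : M) (α : T V x →L[ℝ] ℝ) (v : T V x),
    intProd (sharp (L x) α) (extDer ϑ x + ω x) ![v] = -(α v - α (E x) * ϑ x ![v])

end Manifold

end TwistedJacobi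
end

open TwistedJacobi

open scoped Manifold

noncomputable section

/-! Put `Ω = dϑ + ω`. At each point, `ϑ ∧ Ωⁿ ≠ 0` forces `ker ϑ ∩ ker Ω = 0`, because a top-degree
form annihilated by a nonzero vector vanishes. Hence `B : w ↦ i(w)Ω + ϑ(w)ϑ` is an isomorphism. In
odd dimension the skew form `Ω` has a kernel, on which `ϑ` does not vanish; normalising by `ϑ` gives
`E = B⁻¹ϑ`, and `Λ^# = E ⊗ E - B⁻¹` (`Nondeg.associatedAt`). Uniqueness is again `ker ϑ ∩ ker Ω =
0`, and smoothness holds because inversion of isomorphisms is smooth (`contDiffOn_associated`).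

The differential equations come from differentiating the algebraic relations in a chart, with the
flat derivative `D`. The central formula, `fderiv_omega_sharp_sharp`, is `D_uΩ(Λ^#β, Λ^#γ) =
-D_uΛ(β, γ) + β(E) D_uϑ(Λ^#γ) - γ(E) D_uϑ(Λ^#β)`. For `u = Λ^#α`, summed cyclically, the left side
becomes `dΩ = dω`, the terms in `DΛ` become half of `[Λ, Λ]`, and the terms in `Dϑ` become `dϑ = Ω -
ω`, where `Ω(Λ^#α, Λ^#β) = Λ(α, β)`. Replacing one of the vectors `Λ^#γ` by `E` gives the equation
for `[E, Λ]`.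

Nothing is differentiated along the factor `ℝ`, so the bracket of `(Λ, E)` with itself is the same
cyclic expression. The twisted Jacobi condition, evaluated on `(α, f), (β, g), (γ, h)`, is the first
identity plus `f`, `g`, `h` times instances of the second (`twistedJacobi_flat_pair`).

On `M` every operator at `x` is computed in the chart at `x`, whose differential at `x` is the
identity. The relations are needed on a neighbourhood of `x`, and there `d` has to be compared in
two charts: this is `formInChart_extDer`. -/

namespace TwistedJacobi

/-! ### Wedge products in low degree; top-degree forms with a kernel -/

section WedgeFormulas

variable {W : Type*} [AddCommGroup W] [Module ℝ W] [TopologicalSpace W]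

theorem wedge_apply {p q : ℕ} (α : Form p W) (β : Form q W) (v : Fin (p + q) → W) :
    wedge α β v = ((p.factorial * q.factorial : ℕ) : ℝ)⁻¹ *
      ∑ σ : Equiv.Perm (Fin (p + q)), (Equiv.Perm.sign σ : ℤ) *
        (α (fun i => v (σ (Fin.castAdd q i))) * β (fun j => v (σ (Fin.natAdd p j)))) := by
  rw [wedge, ContinuousAlternatingMap.smul_apply,
    ContinuousMultilinearMap.alternatization_apply_apply, smul_eq_mul]
  congr 1
  refine Finset.sum_congr rfl fun σ _ => ?_
  rw [Units.smul_def, zsmul_eq_mul]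
  rfl

theorem Form.swap (η : Form 2 W) (u v : W) : η ![u, v] = -η ![v, u] := by
  have := η.toAlternatingMap.map_swap ![v, u] (i := 0) (j := 1) (by decide)
  have h : (![v, u] ∘ Equiv.swap (0 : Fin 2) 1) = ![u, v] := by
    funext i; fin_cases i <;> rfl
  rw [h] at this
  exact this

theorem wedge_zero_two (α : Form 0 W) (β : Form 2 W) (u v : W) :
    wedge α β ![u, v] = α ![] * β ![u, v] := by
  rw [wedge_apply]
  have : (Finset.univ : Finset (Equiv.Perm (Fin (0 + 2)))) = {1, Equiv.swap 0 1} := by decide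
  rw [this, Finset.sum_pair (by decide)]
  have h1 : (fun j => (![u, v] : Fin (0 + 2) → W)
      ((1 : Equiv.Perm (Fin (0 + 2))) (Fin.natAdd 0 j))) = ![u, v] := by
    funext i; fin_cases i <;> rfl
  have h2 : (fun j => (![u, v] : Fin (0 + 2) → W)
      ((Equiv.swap 0 1 : Equiv.Perm (Fin (0 + 2))) (Fin.natAdd 0 j))) = ![v, u] := by
    funext i; fin_cases i <;> rfl
  rw [h1, h2, Equiv.Perm.sign_swap (by decide), β.swap v u]
  have h3 : (fun i => (![u, v] : Fin (0 + 2) → W)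
      ((1 : Equiv.Perm (Fin (0 + 2))) (Fin.castAdd 2 i))) = ![] := Subsingleton.elim _ _
  have h4 : (fun i => (![u, v] : Fin (0 + 2) → W)
      ((Equiv.swap 0 1 : Equiv.Perm (Fin (0 + 2))) (Fin.castAdd 2 i))) = ![] :=
    Subsingleton.elim _ _
  rw [h3, h4]
  simp [Nat.factorial]
  ring

theorem wedge_one_one (α β : Form 1 W) (u v : W) :
    wedge α β ![u, v] = α ![u] * β ![v] - α ![v] * β ![u] := by
  rw [wedge_apply]
  have : (Finset.univ : Finset (Equiv.Perm (Fin (1 + 1)))) = {1, Equiv.swap 0 1} := by decide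
  rw [this, Finset.sum_pair (by decide), Equiv.Perm.sign_swap (by decide)]
  have h1 : (fun i => (![u, v] : Fin (1 + 1) → W)
      ((1 : Equiv.Perm (Fin (1 + 1))) (Fin.castAdd 1 i))) = ![u] := by
    funext i; fin_cases i; rfl
  have h2 : (fun i => (![u, v] : Fin (1 + 1) → W)
      ((1 : Equiv.Perm (Fin (1 + 1))) (Fin.natAdd 1 i))) = ![v] := by
    funext i; fin_cases i; rfl
  have h3 : (fun i => (![u, v] : Fin (1 + 1) → W)
      ((Equiv.swap 0 1 : Equiv.Perm (Fin (1 + 1))) (Fin.castAdd 1 i))) = ![v] := by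
    funext i; fin_cases i; rfl
  have h4 : (fun i => (![u, v] : Fin (1 + 1) → W)
      ((Equiv.swap 0 1 : Equiv.Perm (Fin (1 + 1))) (Fin.natAdd 1 i))) = ![u] := by
    funext i; fin_cases i; rfl
  rw [h1, h2, h3, h4]
  simp [Nat.factorial]
  ring

theorem sum_perm_fin_three (f : Equiv.Perm (Fin 3) → ℝ) :
    ∑ σ, (Equiv.Perm.sign σ : ℤ) * f σ =
      f 1 + f (finRotate 3) + f (finRotate 3)⁻¹
        - f (Equiv.swap 0 1) - f (Equiv.swap 0 2) - f (Equiv.swap 1 2) := by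
  have h : (Finset.univ : Finset (Equiv.Perm (Fin 3))) =
      {1, finRotate 3, (finRotate 3)⁻¹, Equiv.swap 0 1, Equiv.swap 0 2, Equiv.swap 1 2} := by
    decide
  have s1 : Equiv.Perm.sign (finRotate 3) = 1 := by decide
  have s2 : Equiv.Perm.sign (finRotate 3)⁻¹ = 1 := by decide
  rw [h]
  repeat rw [Finset.sum_insert (by decide)]
  rw [Finset.sum_singleton, s1, s2, Equiv.Perm.sign_swap (by decide),
    Equiv.Perm.sign_swap (by decide), Equiv.Perm.sign_swap (by decide)]
  simp
  ring

/-- Antisymmetry of `β` groups the six permutations into three equal pairs, and the factor `2`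
cancels `(1! 2!)⁻¹`. -/
theorem wedge_one_two (α : Form 1 W) (β : Form 2 W) (u v w : W) :
    wedge α β ![u, v, w] =
      α ![u] * β ![v, w] + α ![v] * β ![w, u] + α ![w] * β ![u, v] := by
  have key : ∀ (σ : Equiv.Perm (Fin 3)) (x y z : W),
      (![u, v, w] ∘ σ : Fin 3 → W) = ![x, y, z] →
      α (fun i => (![u, v, w] : Fin (1 + 2) → W) (σ (Fin.castAdd 2 i))) *
        β (fun j => (![u, v, w] : Fin (1 + 2) → W) (σ (Fin.natAdd 1 j))) =
      α ![x] * β ![y, z] := by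
    intro σ x y z h
    congr 2
    · funext i; fin_cases i; exact congrFun h 0
    · funext i; fin_cases i
      · exact congrFun h 1
      · exact congrFun h 2
  rw [wedge_apply]
  refine (congrArg _ (sum_perm_fin_three _)).trans ?_
  rw [key 1 u v w (by funext i; fin_cases i <;> rfl),
    key (finRotate 3) v w u (by funext i; fin_cases i <;> rfl),
    key (finRotate 3)⁻¹ w u v (by funext i; fin_cases i <;> rfl),
    key (Equiv.swap 0 1) v u w (by funext i; fin_cases i <;> rfl),
    key (Equiv.swap 0 2) w v u (by funext i; fin_cases i <;> rfl),
    key (Equiv.swap 1 2) u w v (by funext i; fin_cases i <;> rfl),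
    β.swap u w, β.swap v u, β.swap w v]
  simp [Nat.factorial]
  ring

theorem wedge_two_one (α : Form 2 W) (β : Form 1 W) (u v w : W) :
    wedge α β ![u, v, w] =
      α ![u, v] * β ![w] + α ![v, w] * β ![u] + α ![w, u] * β ![v] := by
  have key : ∀ (σ : Equiv.Perm (Fin 3)) (x y z : W),
      (![u, v, w] ∘ σ : Fin 3 → W) = ![x, y, z] →
      α (fun i => (![u, v, w] : Fin (2 + 1) → W) (σ (Fin.castAdd 1 i))) *
        β (fun j => (![u, v, w] : Fin (2 + 1) → W) (σ (Fin.natAdd 2 j))) =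
      α ![x, y] * β ![z] := by
    intro σ x y z h
    congr 2
    · funext i; fin_cases i
      · exact congrFun h 0
      · exact congrFun h 1
    · funext i; fin_cases i; exact congrFun h 2
  rw [wedge_apply]
  refine (congrArg _ (sum_perm_fin_three _)).trans ?_
  rw [key 1 u v w (by funext i; fin_cases i <;> rfl),
    key (finRotate 3) v w u (by funext i; fin_cases i <;> rfl),
    key (finRotate 3)⁻¹ w u v (by funext i; fin_cases i <;> rfl),
    key (Equiv.swap 0 1) v u w (by funext i; fin_cases i <;> rfl),
    key (Equiv.swap 0 2) w v u (by funext i; fin_cases i <;> rfl),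
    key (Equiv.swap 1 2) u w v (by funext i; fin_cases i <;> rfl),
    α.swap u w, α.swap v u, α.swap w v]
  simp [Nat.factorial]
  ring

/-- A form vanishing as soon as one of its arguments is `w`. -/
def InKernel {k : ℕ} (w : W) (η : Form k W) : Prop :=
  ∀ (v : Fin k → W) (i : Fin k), v i = w → η v = 0

/-- In every summand of the wedge product, `w` is an argument of one of the two factors. -/
theorem InKernel.wedge {p q : ℕ} {w : W} {α : Form p W} {β : Form q W}
    (hα : InKernel w α) (hβ : InKernel w β) : InKernel w (wedge α β) := by
  intro v i hi
  rw [wedge_apply]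
  refine mul_eq_zero_of_right _ (Finset.sum_eq_zero fun σ _ => mul_eq_zero_of_right _ ?_)
  obtain ⟨j, rfl⟩ := σ.surjective i
  revert hi
  refine Fin.addCases (fun j hj => ?_) (fun j hj => ?_) j
  · rw [hα _ j hj, zero_mul]
  · rw [hβ _ j hj, mul_zero]

theorem InKernel.wedgePow {w : W} {Φ : Form 2 W} (h : InKernel w Φ) :
    ∀ n, InKernel w (wedgePow Φ n)
  | 0 => fun _ i => i.elim0
  | n + 1 => (InKernel.wedgePow h n).wedge h

theorem InKernel.eq_zero [FiniteDimensional ℝ W] {k : ℕ} {w : W} {η : Form k W}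
    (h : InKernel w η) (hw : w ≠ 0) (hk : Module.finrank ℝ W = k) : η = 0 := by
  have hli : LinearIndepOn ℝ id ({w} : Set W) := LinearIndepOn.singleton hw
  let b := Module.Basis.extend hli
  have hmem : w ∈ hli.extend (Set.subset_univ _) :=
    hli.subset_extend _ (Set.mem_singleton w)
  have : Fintype (hli.extend (Set.subset_univ ({w} : Set W))) :=
    FiniteDimensional.fintypeBasisIndex b
  have hcard : Fintype.card (hli.extend (Set.subset_univ ({w} : Set W))) = k := by
    rw [← hk, Module.finrank_eq_card_basis b]
  let e := Fintype.equivFinOfCardEq hcard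
  apply ContinuousAlternatingMap.toAlternatingMap_injective
  -- An injective family of `k` indices out of `k` is surjective, so `w`, a member of the basis,
  -- occurs among the arguments.
  refine (b.reindex e).ext_alternating fun v hv => ?_
  obtain ⟨i, hi⟩ := (Finite.injective_iff_surjective.1 hv) (e ⟨w, hmem⟩)
  refine (h _ i ?_).trans rfl
  simp [hi, b]

end WedgeFormulas

/-! ### Pointwise algebra: existence, uniqueness and naturality of `(Λ, E)` -/

section AssociatedAlgebra

variable {W : Type*} [AddCommGroup W] [Module ℝ W] [TopologicalSpace W]

theorem Form.one_eta (η : Form 1 W) (v : Fin 1 → W) : η v = η ![v 0] := by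
  congr 1; funext i; fin_cases i; rfl

theorem Form.two_eta (η : Form 2 W) (v : Fin 2 → W) : η v = η ![v 0, v 1] := by
  congr 1; funext i; fin_cases i <;> rfl

theorem Form.three_eta (η : Form 3 W) (v : Fin 3 → W) : η v = η ![v 0, v 1, v 2] := by
  congr 1; funext i; fin_cases i <;> rfl

theorem Form.ext_one {η ξ : Form 1 W} (h : ∀ u, η ![u] = ξ ![u]) : η = ξ := by
  ext v; rw [η.one_eta, ξ.one_eta, h]

theorem Form.ext_two {η ξ : Form 2 W} (h : ∀ u v, η ![u, v] = ξ ![u, v]) : η = ξ := by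
  ext v; rw [η.two_eta, ξ.two_eta, h]

theorem Form.ext_three {η ξ : Form 3 W} (h : ∀ u v w, η ![u, v, w] = ξ ![u, v, w]) : η = ξ := by
  ext v; rw [η.three_eta, ξ.three_eta, h]

theorem Form.self (η : Form 2 W) (u : W) : η ![u, u] = 0 :=
  η.map_eq_zero_of_eq ![u, u] (i := 0) (j := 1) rfl (by decide)

/-- The covector of a 1-form. -/
def Form.covec (θ : Form 1 W) : W →L[ℝ] ℝ := θ.toContinuousLinearMap 0 0

theorem Form.covec_apply (θ : Form 1 W) (v : W) : θ.covec v = θ ![v] := by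
  change θ (Function.update 0 0 v) = _
  congr 1; funext i; fin_cases i; rfl

theorem Form.one_add (θ : Form 1 W) (u v : W) : θ ![u + v] = θ ![u] + θ ![v] := by
  simp only [← Form.covec_apply, map_add]

theorem Form.one_smul (θ : Form 1 W) (c : ℝ) (v : W) : θ ![c • v] = c * θ ![v] := by
  simp only [← Form.covec_apply, map_smul, smul_eq_mul]

/-- The covector `i(w)Ω`. -/
def Form.contr (Ω : Form 2 W) (w : W) : W →L[ℝ] ℝ := (intProd w Ω).covec

theorem Form.contr_apply (Ω : Form 2 W) (w v : W) : Ω.contr w v = Ω ![w, v] :=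
  (intProd w Ω).covec_apply v

theorem Form.two_add_right (Ω : Form 2 W) (w u v : W) :
    Ω ![w, u + v] = Ω ![w, u] + Ω ![w, v] := by
  simp only [← Form.contr_apply, map_add]

theorem Form.two_smul_right (Ω : Form 2 W) (c : ℝ) (w v : W) :
    Ω ![w, c • v] = c * Ω ![w, v] := by
  simp only [← Form.contr_apply, map_smul, smul_eq_mul]

theorem Form.two_add_left (Ω : Form 2 W) (u v w : W) :
    Ω ![u + v, w] = Ω ![u, w] + Ω ![v, w] := by
  rw [Ω.swap, Ω.two_add_right, Ω.swap w u, Ω.swap w v]; ring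

theorem Form.two_smul_left (Ω : Form 2 W) (c : ℝ) (v w : W) :
    Ω ![c • v, w] = c * Ω ![v, w] := by
  rw [Ω.swap, Ω.two_smul_right, Ω.swap w v]; ring

/-- The morphism `w ↦ i(w)Ω + θ(w) θ`. -/
def contactMapₗ (θ : Form 1 W) (Ω : Form 2 W) : W →ₗ[ℝ] (W →L[ℝ] ℝ) where
  toFun w := Ω.contr w + θ ![w] • θ.covec
  map_add' u v := by
    ext w
    simp only [add_apply, smul_apply, Form.contr_apply, Form.two_add_left,
      Form.one_add, smul_eq_mul]
    ring
  map_smul' c v := by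
    ext w
    simp only [add_apply, smul_apply, Form.contr_apply,
      Form.two_smul_left, Form.one_smul, smul_eq_mul, RingHom.id_apply]
    ring

/-- Nondegeneracy of the pair `(θ, Ω)`: the kernels of `θ` and `Ω` meet trivially. -/
def Nondeg (θ : Form 1 W) (Ω : Form 2 W) : Prop :=
  ∀ w, θ ![w] = 0 → (∀ v, Ω ![w, v] = 0) → w = 0

theorem nondeg_of_wedge_ne_zero [FiniteDimensional ℝ W] {n : ℕ} {θ : Form 1 W} {Ω : Form 2 W}
    (hW : Module.finrank ℝ W = 2 * n + 1) (h : wedge θ (wedgePow Ω n) ≠ 0) : Nondeg θ Ω := by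
  intro w h1 h2
  by_contra hw
  refine h (InKernel.eq_zero (w := w) (InKernel.wedge ?_ (InKernel.wedgePow ?_ n)) hw (by omega))
  · intro v i hi
    rw [θ.one_eta, ← h1, ← hi, Subsingleton.elim i 0]
  · intro v i hi
    rw [Ω.two_eta]
    fin_cases i
    · change v 0 = w at hi
      rw [hi, h2]
    · change v 1 = w at hi
      rw [hi, Ω.swap, h2, neg_zero]

theorem exists_kernel_of_odd [FiniteDimensional ℝ W] {n : ℕ} (Ω : Form 2 W)
    (hW : Module.finrank ℝ W = 2 * n + 1) : ∃ w, w ≠ 0 ∧ ∀ v, Ω ![w, v] = 0 := by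
  let b := Module.finBasis ℝ W
  let A : Matrix (Fin (Module.finrank ℝ W)) (Fin (Module.finrank ℝ W)) ℝ :=
    Matrix.of fun i j => Ω ![b j, b i]
  have hA : A.transpose = -A := by
    ext i j
    exact Ω.swap _ _
  have hdet : A.det = 0 := by
    -- `det A = det Aᵀ = det (-A) = -det A`, the size being odd.
    have := A.det_transpose
    rw [hA, Matrix.det_neg, Fintype.card_fin, Odd.neg_one_pow ⟨n, hW⟩] at this
    linarith
  obtain ⟨c, hc, hc'⟩ := Matrix.exists_mulVec_eq_zero_iff.2 hdet
  have key : ∀ v, Ω ![∑ j, c j • b j, v] = ∑ j, c j * Ω ![b j, v] := by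
    intro v
    have : ∀ w, Ω ![w, v] = -Ω.contr v w := fun w => by rw [Ω.contr_apply, ← Ω.swap]
    simp only [this, map_sum, map_smul, smul_eq_mul, mul_neg, Finset.sum_neg_distrib]
  refine ⟨∑ j, c j • b j, fun h => hc ?_, fun v => ?_⟩
  · funext j
    exact Fintype.linearIndependent_iff.1 b.linearIndependent c h j
  · have : Ω.contr (∑ j, c j • b j) = 0 := by
      refine ContinuousLinearMap.coe_injective (b.ext fun i => ?_)
      change Ω.contr _ (b i) = 0
      rw [Ω.contr_apply, key]
      refine Eq.trans (Finset.sum_congr rfl fun j _ => mul_comm _ _) (congrFun hc' i)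
    rw [← Ω.contr_apply, this]; rfl

variable [IsTopologicalAddGroup W] [ContinuousSMul ℝ W] [T2Space W] [FiniteDimensional ℝ W]

/-- The pointwise form of `IsAssociatedPair`. -/
structure AssociatedAt (θ : Form 1 W) (Ω : Form 2 W) (L : MultiVec 2 W) (E : W) : Prop where
  reeb_one : θ ![E] = 1
  reeb_two : ∀ v, Ω ![E, v] = 0
  sharp_one : sharp L θ.covec = 0
  sharp_two : ∀ α v, Ω ![sharp L α, v] = -(α v - α E * θ ![v])

namespace AssociatedAt

variable {θ : Form 1 W} {Ω : Form 2 W} {L L' : MultiVec 2 W} {E E' : W}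

/-- By skewness, `θ(Λ^#α) = Λ(α, θ) = -Λ(θ, α) = -α(Λ^#θ)`. -/
theorem theta_sharp (h : AssociatedAt θ Ω L E) (α : W →L[ℝ] ℝ) : θ ![sharp L α] = 0 := by
  rw [← Form.covec_apply, apply_sharp, Form.swap, ← apply_sharp, h.sharp_one, map_zero, neg_zero]

/-- On a vector in both kernels, `sharp_two` says that every covector vanishes. Uniqueness and the
inversion formulas thus need only the relations themselves. -/
theorem nondeg (h : AssociatedAt θ Ω L E) : Nondeg θ Ω := by
  intro w h1 h2
  by_contra hw
  obtain ⟨f, hf⟩ : ∃ f : W →ₗ[ℝ] ℝ, f w ≠ 0 := by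
    by_contra! hf
    exact hw ((Module.forall_dual_apply_eq_zero_iff ℝ w).1 hf)
  have := h.sharp_two (LinearMap.toContinuousLinearMap f) w
  rw [Ω.swap, h2, h1] at this
  simp at this
  exact hf this

theorem unique (h : AssociatedAt θ Ω L E) (h' : AssociatedAt θ Ω L' E') : L = L' ∧ E = E' := by
  have hE : E = E' := by
    refine sub_eq_zero.1 (h.nondeg _ ?_ fun v => ?_)
    · rw [← Form.covec_apply, map_sub, Form.covec_apply, Form.covec_apply, h.reeb_one,
        h'.reeb_one, sub_self]
    · rw [Ω.swap, ← Form.contr_apply, map_sub, Form.contr_apply, Form.contr_apply, Ω.swap v,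
        Ω.swap v, h.reeb_two, h'.reeb_two]
      simp
  subst hE
  refine ⟨Form.ext_two fun α β => ?_, rfl⟩
  rw [← apply_sharp, ← apply_sharp]
  congr 1
  refine sub_eq_zero.1 (h.nondeg _ ?_ fun v => ?_)
  · rw [← Form.covec_apply, map_sub, Form.covec_apply, Form.covec_apply, h.theta_sharp,
      h'.theta_sharp, sub_self]
  · rw [Ω.swap, ← Form.contr_apply, map_sub, Form.contr_apply, Form.contr_apply, Ω.swap v,
        Ω.swap v, h.sharp_two, h'.sharp_two]
    simp

/-- This is where the `Ω`-part of `dϑ = Ω - ω` becomes the term `E ∧ Λ` of the first twisted Jacobi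
equation. -/
theorem bivector_apply (h : AssociatedAt θ Ω L E) (α β : W →L[ℝ] ℝ) :
    Ω ![sharp L α, sharp L β] = L ![α, β] := by
  rw [h.sharp_two, h.theta_sharp, apply_sharp, Form.swap L β α]
  ring

end AssociatedAt

/-- The morphism `w ↦ i(w)Ω + θ(w) θ`, as a continuous linear map. -/
def contactMap (θ : Form 1 W) (Ω : Form 2 W) : W →L[ℝ] (W →L[ℝ] ℝ) :=
  LinearMap.toContinuousLinearMap (contactMapₗ θ Ω)

theorem contactMap_apply (θ : Form 1 W) (Ω : Form 2 W) (w v : W) :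
    contactMap θ Ω w v = Ω ![w, v] + θ ![w] * θ ![v] := by
  change Ω.contr w v + θ ![w] * θ.covec v = _
  rw [Form.contr_apply, Form.covec_apply]

/-- The vector `E` associated to `(θ, Ω)`. -/
def reeb (θ : Form 1 W) (Ω : Form 2 W) : W := (contactMap θ Ω).inverse θ.covec

/-- The morphism `Λ^#` of the bivector associated to `(θ, Ω)`. -/
def contactSharp (θ : Form 1 W) (Ω : Form 2 W) : (W →L[ℝ] ℝ) →L[ℝ] W :=
  ({ toFun := fun α => α (reeb θ Ω)
     map_add' := fun _ _ => rfl
     map_smul' := fun _ _ => rfl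
     cont := continuous_eval_const _ } : (W →L[ℝ] ℝ) →L[ℝ] ℝ).smulRight (reeb θ Ω) -
    (contactMap θ Ω).inverse

/-- The bivector associated to `(θ, Ω)`. -/
def contactBivec (θ : Form 1 W) (Ω : Form 2 W) : MultiVec 2 W :=
  Ω.compContinuousLinearMap (contactSharp θ Ω)

theorem Nondeg.bijective {θ : Form 1 W} {Ω : Form 2 W} (hn : Nondeg θ Ω) :
    Function.Bijective (contactMapₗ θ Ω) := by
  have key : ∀ w v, contactMapₗ θ Ω w v = Ω ![w, v] + θ ![w] * θ ![v] := contactMap_apply θ Ω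
  have hinj : Function.Injective (contactMapₗ θ Ω) := by
    rw [injective_iff_map_eq_zero]
    intro w hw
    have h0 : ∀ v, Ω ![w, v] + θ ![w] * θ ![v] = 0 := fun v => by rw [← key, hw]; rfl
    -- Pairing the image of `w` with `w` itself leaves `θ(w)² = 0`.
    have h1 : θ ![w] = 0 := by
      have := h0 w
      rw [Ω.self, zero_add] at this
      exact mul_self_eq_zero.1 this
    refine hn w h1 fun v => ?_
    have := h0 v
    rwa [h1, zero_mul, add_zero] at this
  refine ⟨hinj, ?_⟩
  let D : (W →ₗ[ℝ] ℝ) ≃ₗ[ℝ] (W →L[ℝ] ℝ) := LinearMap.toContinuousLinearMap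
  have : FiniteDimensional ℝ (W →L[ℝ] ℝ) := D.finiteDimensional
  refine (LinearMap.injective_iff_surjective_of_finrank_eq_finrank ?_).1 hinj
  rw [← D.finrank_eq]
  exact (Subspace.dual_finrank_eq).symm

theorem Nondeg.isInvertible {θ : Form 1 W} {Ω : Form 2 W} (hn : Nondeg θ Ω) :
    (contactMap θ Ω).IsInvertible := by
  let D : (W →ₗ[ℝ] ℝ) ≃ₗ[ℝ] (W →L[ℝ] ℝ) := LinearMap.toContinuousLinearMap
  have : FiniteDimensional ℝ (W →L[ℝ] ℝ) := D.finiteDimensional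
  exact ⟨(LinearEquiv.ofBijective _ hn.bijective).toContinuousLinearEquiv, rfl⟩

theorem Nondeg.associatedAt {θ : Form 1 W} {Ω : Form 2 W} (hn : Nondeg θ Ω) {n : ℕ}
    (hW : Module.finrank ℝ W = 2 * n + 1) :
    AssociatedAt θ Ω (contactBivec θ Ω) (reeb θ Ω) := by
  obtain ⟨e, he⟩ := hn.isInvertible
  have hinv : ∀ α v, Ω ![(contactMap θ Ω).inverse α, v] +
      θ ![(contactMap θ Ω).inverse α] * θ ![v] = α v := by
    intro α v
    rw [← contactMap_apply, ← he, ContinuousLinearMap.inverse_equiv]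
    exact congrFun (congrArg _ (e.apply_symm_apply α)) v
  obtain ⟨w, hw0, hw⟩ := exists_kernel_of_odd Ω hW
  have hθw : θ ![w] ≠ 0 := fun h => hw0 (hn w h hw)
  -- The kernel vector supplied by odd dimension, scaled to `θ = 1`, is sent to `θ` by `contactMap`.
  have hE : reeb θ Ω = (θ ![w])⁻¹ • w := by
    rw [reeb, ← he, ContinuousLinearMap.inverse_equiv]
    refine e.injective ?_
    change e (e.symm _) = _
    rw [e.apply_symm_apply]
    ext v
    change _ = (e : W →L[ℝ] (W →L[ℝ] ℝ)) _ v
    rw [he, contactMap_apply, Form.two_smul_left, hw, Form.one_smul, Form.covec_apply]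
    field_simp
    ring
  have h1 : θ ![reeb θ Ω] = 1 := by
    rw [hE, Form.one_smul, inv_mul_cancel₀ hθw]
  have h2 : ∀ v, Ω ![reeb θ Ω, v] = 0 := fun v => by rw [hE, Form.two_smul_left, hw, mul_zero]
  have hS : ∀ α, contactSharp θ Ω α = α (reeb θ Ω) • reeb θ Ω + -(contactMap θ Ω).inverse α :=
    fun α => sub_eq_add_neg _ _
  have hθS : ∀ α, θ ![contactSharp θ Ω α] = 0 := by
    intro α
    have := hinv α (reeb θ Ω)
    rw [Ω.swap, h2, h1] at this
    rw [hS, Form.one_add, Form.one_smul, h1, ← neg_one_smul ℝ, Form.one_smul]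
    linarith
  have hΩS : ∀ α v, Ω ![contactSharp θ Ω α, v] = -(α v - α (reeb θ Ω) * θ ![v]) := by
    intro α v
    have h3 := hinv α (reeb θ Ω)
    rw [Ω.swap, h2, h1] at h3
    have h4 := hinv α v
    rw [hS, Form.two_add_left, Form.two_smul_left, h2, ← neg_one_smul ℝ, Form.two_smul_left]
    -- The defining equation of the inverse, paired with the kernel vector `E`, loses its `Ω`-term.
    have h5 : θ ![(contactMap θ Ω).inverse α] = α (reeb θ Ω) := by linarith
    rw [h5] at h4
    linarith
  have hsharp : ∀ α, sharp (contactBivec θ Ω) α = contactSharp θ Ω α := by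
    intro α
    refine sub_eq_zero.1 ((Module.forall_dual_apply_eq_zero_iff ℝ _).1 fun f => ?_)
    let β : W →L[ℝ] ℝ := LinearMap.toContinuousLinearMap f
    change β _ = 0
    rw [map_sub, apply_sharp]
    have h6 : contactBivec θ Ω ![α, β] = Ω ![contactSharp θ Ω α, contactSharp θ Ω β] := by
      rw [contactBivec, ContinuousAlternatingMap.compContinuousLinearMap_apply, Form.two_eta]
      rfl
    rw [h6, Ω.swap, hΩS, hθS]
    ring
  refine ⟨h1, h2, ?_, fun α v => by rw [hsharp, hΩS]⟩
  rw [hsharp]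
  refine hn _ (hθS _) fun v => ?_
  rw [hΩS, Form.covec_apply, Form.covec_apply, h1]
  ring

variable {W' : Type*} [AddCommGroup W'] [Module ℝ W'] [TopologicalSpace W']
  [IsTopologicalAddGroup W'] [ContinuousSMul ℝ W'] [T2Space W'] [FiniteDimensional ℝ W']

theorem sharp_push (f : W →L[ℝ] W') (L : MultiVec 2 W) (α : W' →L[ℝ] ℝ) :
    sharp (push f L) α = f (sharp L (α.comp f)) := by
  refine sub_eq_zero.1 ((Module.forall_dual_apply_eq_zero_iff ℝ _).1 fun g => ?_)
  let β : W' →L[ℝ] ℝ := LinearMap.toContinuousLinearMap g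
  change β _ = 0
  rw [map_sub, apply_sharp, push_apply, Form.two_eta, sub_eq_zero, ← apply_sharp]
  rfl

/-- The relations are natural under isomorphisms; applied to the differential of a chart, this moves
them to an open subset of `V`. -/
theorem AssociatedAt.map {θ : Form 1 W} {Ω : Form 2 W} {L : MultiVec 2 W} {E : W}
    (h : AssociatedAt θ Ω L E) (f : W →L[ℝ] W') (g : W' →L[ℝ] W)
    (hfg : ∀ w, f (g w) = w) (hgf : ∀ w, g (f w) = w) :
    AssociatedAt (θ.compContinuousLinearMap g) (Ω.compContinuousLinearMap g) (push f L) (f E) := by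
  have h1 : ∀ v, θ.compContinuousLinearMap g ![v] = θ ![g v] := fun v => Form.one_eta θ _
  have h2 : ∀ u v, Ω.compContinuousLinearMap g ![u, v] = Ω ![g u, g v] :=
    fun u v => Form.two_eta Ω _
  refine ⟨?_, fun v => ?_, ?_, fun α v => ?_⟩
  · rw [h1, hgf, h.reeb_one]
  · rw [h2, hgf, h.reeb_two]
  · rw [sharp_push]
    have : (Form.covec (θ.compContinuousLinearMap g)).comp f = θ.covec := by
      ext w
      change Form.covec (θ.compContinuousLinearMap g) (f w) = _
      rw [Form.covec_apply, h1, hgf, Form.covec_apply]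
    rw [this, h.sharp_one, map_zero]
  · rw [sharp_push, h2, hgf, h.sharp_two, h1]
    simp only [ContinuousLinearMap.comp_apply, hfg]

end AssociatedAlgebra

/-! ### Differentiating the relations in a vector space -/

section FlatIdentities

open Topology

variable {V : Type*} [NormedAddCommGroup V] [NormedSpace ℝ V]
variable {A : Type*} [NormedAddCommGroup A] [NormedSpace ℝ A]

theorem fderiv_clm_apply_comp {F G : Type*} [NormedAddCommGroup F] [NormedSpace ℝ F]
    [NormedAddCommGroup G] [NormedSpace ℝ G] (S : F →L[ℝ] G) {f : V → F} {y : V}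
    (hf : DifferentiableAt ℝ f y) (u : V) :
    fderiv ℝ (fun z => S (f z)) y u = S (fderiv ℝ f y u) :=
  DFunLike.congr_fun (S.hasFDerivAt.comp y hf.hasFDerivAt).fderiv u

theorem fderiv_form_one {η : V → Form 1 A} {a : V → A} {y : V} (hη : DifferentiableAt ℝ η y)
    (ha : DifferentiableAt ℝ a y) (u : V) :
    fderiv ℝ (fun z => η z ![a z]) y u = fderiv ℝ η y u ![a y] + η y ![fderiv ℝ a y u] := by
  have h := fderiv_continuousAlternatingMap_apply_apply (g := fun _ => a) hη (fun _ => ha) u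
  have e : ∀ z, (fun _ : Fin 1 => a z) = ![a z] := fun z => by funext i; fin_cases i; rfl
  have e' : ∀ v w : A, Function.update (![v] : Fin 1 → A) 0 w = ![w] := fun v w => by
    funext i; fin_cases i; rfl
  simpa only [e, e', Finset.univ_unique, Finset.sum_singleton, Fin.default_eq_zero] using h

theorem fderiv_form_two {η : V → Form 2 A} {a : V → A} {y : V} (hη : DifferentiableAt ℝ η y)
    (ha : DifferentiableAt ℝ a y) (b : A) (u : V) :
    fderiv ℝ (fun z => η z ![a z, b]) y u =
      fderiv ℝ η y u ![a y, b] + η y ![fderiv ℝ a y u, b] := by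
  have hd : ∀ i : Fin 2, DifferentiableAt ℝ ((![a, fun _ => b] : Fin 2 → V → A) i) y := by
    intro i
    fin_cases i
    · exact ha
    · exact differentiableAt_const b
  have h := fderiv_continuousAlternatingMap_apply_apply hη hd u
  have e : ∀ z, (fun i => (![a, fun _ => b] : Fin 2 → V → A) i z) = ![a z, b] := fun z => by
    funext i; fin_cases i <;> rfl
  have h0 : fderiv ℝ ((![a, fun _ => b] : Fin 2 → V → A) 1) y u = 0 := by
    change fderiv ℝ (fun _ : V => b) y u = 0
    simp
  have e' : Function.update (![a y, b] : Fin 2 → A) 0 (fderiv ℝ a y u) =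
      ![fderiv ℝ a y u, b] := by
    funext i; fin_cases i <;> rfl
  simp only [e, Fin.sum_univ_two, h0, ContinuousAlternatingMap.map_update_zero, add_zero] at h
  rw [h, ← e']
  rfl

theorem extDeriv_one_apply (θ : V → Form 1 V) (y u v : V) :
    extDeriv θ y ![u, v] = fderiv ℝ θ y u ![v] - fderiv ℝ θ y v ![u] := by
  rw [extDeriv, ContinuousAlternatingMap.alternatizeUncurryFin_apply, Fin.sum_univ_two,
    Form.one_eta, Form.one_eta (fderiv ℝ θ y _)]
  have h1 : Fin.removeNth 1 ![u, v] 0 = u := rfl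
  simp [Form.one_eta (fderiv ℝ θ y v), h1]
  ring

theorem extDeriv_two_apply (Ω : V → Form 2 V) (y u v w : V) :
    extDeriv Ω y ![u, v, w] =
      fderiv ℝ Ω y u ![v, w] - fderiv ℝ Ω y v ![u, w] + fderiv ℝ Ω y w ![u, v] := by
  rw [extDeriv, ContinuousAlternatingMap.alternatizeUncurryFin_apply, Fin.sum_univ_three]
  have h1 : Fin.removeNth 1 ![u, v, w] = ![u, w] := by funext i; fin_cases i <;> rfl
  have h2 : Fin.removeNth 2 ![u, v, w] = ![u, v] := by funext i; fin_cases i <;> rfl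
  simp [h1, h2]
  ring

variable [FiniteDimensional ℝ V] [FiniteDimensional ℝ A]

/-- The map `P ↦ P^#(α)`. -/
def sharpEval (α : A →L[ℝ] ℝ) : MultiVec 2 A →L[ℝ] A :=
  ∑ i, (ContinuousAlternatingMap.apply ℝ (A →L[ℝ] ℝ) ℝ
    ![α, LinearMap.toContinuousLinearMap ((Module.finBasis ℝ A).coord i)]).smulRight
      (Module.finBasis ℝ A i)

theorem sharpEval_apply (α : A →L[ℝ] ℝ) (P : MultiVec 2 A) : sharpEval α P = sharp P α := by
  conv_rhs => rw [← (Module.finBasis ℝ A).sum_repr (sharp P α)]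
  rw [sharpEval, sum_apply]
  refine Finset.sum_congr rfl fun i _ => ?_
  change P ![α, LinearMap.toContinuousLinearMap ((Module.finBasis ℝ A).coord i)] •
    Module.finBasis ℝ A i = _
  rw [← apply_sharp]
  rfl

omit [FiniteDimensional ℝ V] in
theorem differentiableAt_sharp {L : V → MultiVec 2 A} {y : V} (hL : DifferentiableAt ℝ L y)
    (α : A →L[ℝ] ℝ) : DifferentiableAt ℝ (fun z => sharp (L z) α) y := by
  simp only [← sharpEval_apply]
  have h : DifferentiableAt ℝ (sharpEval α) (L y) := by fun_prop
  exact h.comp y hL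

omit [FiniteDimensional ℝ V] in
-- For fixed `α`, `P ↦ P^#(α)` is linear (`sharpEval`), so it commutes with differentiation.
theorem fderiv_sharp {L : V → MultiVec 2 A} {y : V} (hL : DifferentiableAt ℝ L y)
    (α : A →L[ℝ] ℝ) (u : V) :
    fderiv ℝ (fun z => sharp (L z) α) y u = sharp (fderiv ℝ L y u) α := by
  simp only [← sharpEval_apply]
  exact fderiv_clm_apply_comp (F := MultiVec 2 A) (sharpEval α) hL u

section Associated

variable {θ : V → Form 1 V} {Ω : V → Form 2 V} {L : V → MultiVec 2 V} {E : V → V} {y : V}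

theorem fderiv_theta_reeb (h : ∀ᶠ z in 𝓝 y, AssociatedAt (θ z) (Ω z) (L z) (E z))
    (hθ : DifferentiableAt ℝ θ y) (hE : DifferentiableAt ℝ E y) (u : V) :
    fderiv ℝ θ y u ![E y] + θ y ![fderiv ℝ E y u] = 0 := by
  rw [← fderiv_form_one hθ hE]
  have : (fun z => θ z ![E z]) =ᶠ[𝓝 y] fun _ => 1 := h.mono fun z hz => hz.reeb_one
  rw [this.fderiv_eq]
  simp

theorem fderiv_omega_reeb (h : ∀ᶠ z in 𝓝 y, AssociatedAt (θ z) (Ω z) (L z) (E z))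
    (hΩ : DifferentiableAt ℝ Ω y) (hE : DifferentiableAt ℝ E y) (u v : V) :
    fderiv ℝ Ω y u ![E y, v] + Ω y ![fderiv ℝ E y u, v] = 0 := by
  rw [← fderiv_form_two hΩ hE]
  have : (fun z => Ω z ![E z, v]) =ᶠ[𝓝 y] fun _ => 0 := h.mono fun z hz => hz.reeb_two v
  rw [this.fderiv_eq]
  simp

theorem fderiv_theta_sharp (h : ∀ᶠ z in 𝓝 y, AssociatedAt (θ z) (Ω z) (L z) (E z))
    (hθ : DifferentiableAt ℝ θ y) (hL : DifferentiableAt ℝ L y) (α : V →L[ℝ] ℝ) (u : V) :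
    fderiv ℝ θ y u ![sharp (L y) α] + θ y ![sharp (fderiv ℝ L y u) α] = 0 := by
  rw [← fderiv_sharp hL, ← fderiv_form_one hθ (differentiableAt_sharp hL α)]
  have : (fun z => θ z ![sharp (L z) α]) =ᶠ[𝓝 y] fun _ => 0 :=
    h.mono fun z hz => hz.theta_sharp α
  rw [this.fderiv_eq]
  simp

theorem fderiv_omega_sharp (h : ∀ᶠ z in 𝓝 y, AssociatedAt (θ z) (Ω z) (L z) (E z))
    (hθ : DifferentiableAt ℝ θ y) (hΩ : DifferentiableAt ℝ Ω y) (hL : DifferentiableAt ℝ L y)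
    (hE : DifferentiableAt ℝ E y) (α : V →L[ℝ] ℝ) (u v : V) :
    fderiv ℝ Ω y u ![sharp (L y) α, v] + Ω y ![sharp (fderiv ℝ L y u) α, v] =
      α (fderiv ℝ E y u) * θ y ![v] + α (E y) * fderiv ℝ θ y u ![v] := by
  rw [← fderiv_sharp hL, ← fderiv_form_two hΩ (differentiableAt_sharp hL α)]
  have : (fun z => Ω z ![sharp (L z) α, v]) =ᶠ[𝓝 y] fun z => -(α v - α (E z) * θ z ![v]) :=
    h.mono fun z hz => hz.sharp_two α v
  rw [this.fderiv_eq]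
  have h1 : HasFDerivAt (fun z => α (E z)) (α.comp (fderiv ℝ E y)) y :=
    α.hasFDerivAt.comp y hE.hasFDerivAt
  have h2 : HasFDerivAt (fun z => θ z ![v])
      ((ContinuousAlternatingMap.apply ℝ V ℝ ![v]).comp (fderiv ℝ θ y)) y :=
    (ContinuousAlternatingMap.apply ℝ V ℝ ![v]).hasFDerivAt.comp y hθ.hasFDerivAt
  have h3 : HasFDerivAt (fun z => -(α v - α (E z) * θ z ![v])) _ y :=
    ((h1.mul h2).const_sub (α v)).neg
  rw [h3.fderiv]
  change - -(α (E y) * fderiv ℝ θ y u ![v] + θ y ![v] * α (fderiv ℝ E y u)) = _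
  ring

/-- The derivative of `sharp_two` is taken at `v = Λ^#γ`, where `θ(v) = 0` removes the derivative of
`E`. The remaining term `Ω((DΛ)^#β, Λ^#γ)` is evaluated by `sharp_two` for `γ`, and `θ((DΛ)^#β)` by
differentiating `θ(Λ^#β) = 0`. -/
theorem fderiv_omega_sharp_sharp
    (h : ∀ᶠ z in 𝓝 y, AssociatedAt (θ z) (Ω z) (L z) (E z))
    (hθ : DifferentiableAt ℝ θ y) (hΩ : DifferentiableAt ℝ Ω y) (hL : DifferentiableAt ℝ L y)
    (hE : DifferentiableAt ℝ E y) (β γ : V →L[ℝ] ℝ) (u : V) :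
    fderiv ℝ Ω y u ![sharp (L y) β, sharp (L y) γ] =
      -fderiv ℝ L y u ![β, γ] + β (E y) * fderiv ℝ θ y u ![sharp (L y) γ]
        - γ (E y) * fderiv ℝ θ y u ![sharp (L y) β] := by
  have h0 := h.self_of_nhds
  have h1 := fderiv_omega_sharp h hθ hΩ hL hE β u (sharp (L y) γ)
  have h2 := h0.sharp_two γ (sharp (fderiv ℝ L y u) β)
  rw [apply_sharp] at h2
  have h3 := fderiv_theta_sharp h hθ hL β u
  rw [h0.theta_sharp, Form.swap (Ω y), h2] at h1
  linear_combination h1 + γ (E y) * h3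

/-- The derivative of `i(E)Ω = 0` is contracted with `Λ^#β`; `sharp_two` then evaluates `Ω` on `DE`.
-/
theorem fderiv_omega_sharp_reeb
    (h : ∀ᶠ z in 𝓝 y, AssociatedAt (θ z) (Ω z) (L z) (E z))
    (hθ : DifferentiableAt ℝ θ y) (hΩ : DifferentiableAt ℝ Ω y)
    (hE : DifferentiableAt ℝ E y) (β : V →L[ℝ] ℝ) (u : V) :
    fderiv ℝ Ω y u ![sharp (L y) β, E y] =
      β (fderiv ℝ E y u) + β (E y) * fderiv ℝ θ y u ![E y] := by
  have h1 := fderiv_omega_reeb h hΩ hE u (sharp (L y) β)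
  have h2 := h.self_of_nhds.sharp_two β (fderiv ℝ E y u)
  have h3 := fderiv_theta_reeb h hθ hE u
  rw [Form.swap (Ω y), h2] at h1
  rw [Form.swap]
  linear_combination -h1 - β (E y) * h3

/-- The cyclic sum of `DΩ` is `dΩ`; the six terms in `Dθ` pair off into three values of `dθ`. -/
theorem cyclic_fderiv_bivector
    (h : ∀ᶠ z in 𝓝 y, AssociatedAt (θ z) (Ω z) (L z) (E z))
    (hθ : DifferentiableAt ℝ θ y) (hΩ : DifferentiableAt ℝ Ω y) (hL : DifferentiableAt ℝ L y)
    (hE : DifferentiableAt ℝ E y) (α β γ : V →L[ℝ] ℝ) :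
    fderiv ℝ L y (sharp (L y) α) ![β, γ] + fderiv ℝ L y (sharp (L y) β) ![γ, α]
        + fderiv ℝ L y (sharp (L y) γ) ![α, β] =
      -extDeriv Ω y ![sharp (L y) α, sharp (L y) β, sharp (L y) γ]
        - γ (E y) * extDeriv θ y ![sharp (L y) α, sharp (L y) β]
        - α (E y) * extDeriv θ y ![sharp (L y) β, sharp (L y) γ]
        - β (E y) * extDeriv θ y ![sharp (L y) γ, sharp (L y) α] := by
  have k := fderiv_omega_sharp_sharp h hθ hΩ hL hE
  simp only [extDeriv_one_apply, extDeriv_two_apply]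
  rw [Form.swap (fderiv ℝ Ω y (sharp (L y) β)), k, k, k]
  ring

theorem lie_reeb_bivector
    (h : ∀ᶠ z in 𝓝 y, AssociatedAt (θ z) (Ω z) (L z) (E z))
    (hθ : DifferentiableAt ℝ θ y) (hΩ : DifferentiableAt ℝ Ω y) (hL : DifferentiableAt ℝ L y)
    (hE : DifferentiableAt ℝ E y) (α β : V →L[ℝ] ℝ) :
    fderiv ℝ L y (E y) ![α, β] - β (fderiv ℝ E y (sharp (L y) α))
        + α (fderiv ℝ E y (sharp (L y) β)) =
      -extDeriv Ω y ![sharp (L y) α, sharp (L y) β, E y]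
        + β (E y) * extDeriv θ y ![sharp (L y) α, E y]
        - α (E y) * extDeriv θ y ![sharp (L y) β, E y] := by
  have k := fderiv_omega_sharp_sharp h hθ hΩ hL hE
  have k2 := fderiv_omega_sharp_reeb h hθ hΩ hE
  simp only [extDeriv_one_apply, extDeriv_two_apply]
  rw [k, k2, k2]
  ring

end Associated

section Twisted

variable {θ : V → Form 1 V} {ω : V → Form 2 V} {L : V → MultiVec 2 V} {E : V → V} {y : V}

omit [FiniteDimensional ℝ V] in
-- Since `d² = 0`, only `ω` contributes to `d(dθ + ω)`.
theorem extDeriv_contact (hθ : ContDiffAt ℝ 2 θ y) (hω : DifferentiableAt ℝ ω y) :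
    DifferentiableAt ℝ (fun z => extDeriv θ z + ω z) y ∧
      extDeriv (fun z => extDeriv θ z + ω z) y = extDeriv ω y := by
  have h1 : DifferentiableAt ℝ (extDeriv θ) y := by
    have h2 : DifferentiableAt ℝ (fderiv ℝ θ) y :=
      (hθ.fderiv_right (m := 1) (by norm_num)).differentiableAt (by norm_num)
    exact (ContinuousAlternatingMap.alternatizeUncurryFinCLM ℝ V ℝ).differentiableAt.comp y h2
  refine ⟨h1.add hω, ?_⟩
  rw [extDeriv_fun_add h1 hω, extDeriv_extDeriv_apply hθ (by simp), zero_add]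

theorem twisted_cyclic_identity
    (h : ∀ᶠ z in 𝓝 y, AssociatedAt (θ z) (extDeriv θ z + ω z) (L z) (E z))
    (hθ : ContDiffAt ℝ 2 θ y) (hω : DifferentiableAt ℝ ω y) (hL : DifferentiableAt ℝ L y)
    (hE : DifferentiableAt ℝ E y) (α β γ : V →L[ℝ] ℝ) :
    fderiv ℝ L y (sharp (L y) α) ![β, γ] + fderiv ℝ L y (sharp (L y) β) ![γ, α]
        + fderiv ℝ L y (sharp (L y) γ) ![α, β]
        + (α (E y) * L y ![β, γ] + β (E y) * L y ![γ, α] + γ (E y) * L y ![α, β]) =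
      -extDeriv ω y ![sharp (L y) α, sharp (L y) β, sharp (L y) γ]
        + (γ (E y) * ω y ![sharp (L y) α, sharp (L y) β]
        + α (E y) * ω y ![sharp (L y) β, sharp (L y) γ]
        + β (E y) * ω y ![sharp (L y) γ, sharp (L y) α]) := by
  obtain ⟨hΩ, hd⟩ := extDeriv_contact hθ hω
  have h0 := h.self_of_nhds
  have hdθ := hθ.differentiableAt (by norm_num)
  rw [cyclic_fderiv_bivector h hdθ hΩ hL hE, hd, ← h0.bivector_apply, ← h0.bivector_apply,
    ← h0.bivector_apply]
  simp only [ContinuousAlternatingMap.add_apply]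
  ring

theorem twisted_lie_identity
    (h : ∀ᶠ z in 𝓝 y, AssociatedAt (θ z) (extDeriv θ z + ω z) (L z) (E z))
    (hθ : ContDiffAt ℝ 2 θ y) (hω : DifferentiableAt ℝ ω y) (hL : DifferentiableAt ℝ L y)
    (hE : DifferentiableAt ℝ E y) (α β : V →L[ℝ] ℝ) :
    fderiv ℝ L y (E y) ![α, β] - β (fderiv ℝ E y (sharp (L y) α))
        + α (fderiv ℝ E y (sharp (L y) β)) =
      -extDeriv ω y ![sharp (L y) α, sharp (L y) β, E y]
        - β (E y) * ω y ![sharp (L y) α, E y] + α (E y) * ω y ![sharp (L y) β, E y] := by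
  obtain ⟨hΩ, hd⟩ := extDeriv_contact hθ hω
  have h0 := h.self_of_nhds
  have hdθ := hθ.differentiableAt (by norm_num)
  -- The relation `i(E)(dθ + ω) = 0` trades `dθ` for `-ω` whenever `E` is an argument.
  have h1 : ∀ v, extDeriv θ y ![v, E y] = -ω y ![v, E y] := by
    intro v
    have := h0.reeb_two v
    rw [Form.swap, ContinuousAlternatingMap.add_apply] at this
    linarith
  rw [lie_reeb_bivector h hdθ hΩ hL hE, hd, h1, h1]
  ring

end Twisted

end FlatIdentities

/-! ### Finite-dimensionality and smoothness of families of 2-forms -/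

section Evaluation

variable {N : Type*} [NormedAddCommGroup N] [NormedSpace ℝ N] [FiniteDimensional ℝ N]

/-- The values of a 2-form on the pairs of basis vectors. -/
def evalBasis : Form 2 N →ₗ[ℝ]
    (Fin (Module.finrank ℝ N) × Fin (Module.finrank ℝ N) → ℝ) where
  toFun η p := η ![Module.finBasis ℝ N p.1, Module.finBasis ℝ N p.2]
  map_add' _ _ := rfl
  map_smul' _ _ := rfl

theorem evalBasis_injective : Function.Injective (evalBasis (N := N)) := by
  rw [injective_iff_map_eq_zero]
  intro η h
  apply ContinuousAlternatingMap.toAlternatingMap_injective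
  refine (Module.finBasis ℝ N).ext_alternating fun v _ => ?_
  exact (η.two_eta _).trans (congrFun h (v 0, v 1))

/-- Linear maps out of bivectors, such as `pairₗ`, are thereby continuous and commute with
derivatives. -/
instance : FiniteDimensional ℝ (Form 2 N) :=
  Module.Finite.of_injective evalBasis evalBasis_injective

/-- A family of 2-forms is smooth when its values on pairs of vectors are. -/
theorem contDiffOn_form_two {V : Type*} [NormedAddCommGroup V] [NormedSpace ℝ V]
    {f : V → Form 2 N} {s : Set V} {r : WithTop ℕ∞}
    (h : ∀ u v, ContDiffOn ℝ r (fun y => f y ![u, v]) s) : ContDiffOn ℝ r f s := by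
  obtain ⟨K, hK⟩ := (evalBasis (N := N)).exists_leftInverse_of_injective
    (LinearMap.ker_eq_bot.2 evalBasis_injective)
  have h1 : ContDiffOn ℝ r (fun y => evalBasis (f y)) s := contDiffOn_pi.2 fun p => h _ _
  have h2 : f = fun y => LinearMap.toContinuousLinearMap K (evalBasis (f y)) :=
    funext fun y => (LinearMap.congr_fun hK (f y)).symm
  rw [h2]
  exact (ContinuousLinearMap.contDiff (F := Form 2 N)
    (LinearMap.toContinuousLinearMap K)).comp_contDiffOn h1

end Evaluation

theorem fderiv_linearMap_comp {V F G : Type*} [NormedAddCommGroup V] [NormedSpace ℝ V]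
    [NormedAddCommGroup F] [NormedSpace ℝ F] [FiniteDimensional ℝ F]
    [NormedAddCommGroup G] [NormedSpace ℝ G] (S : F →ₗ[ℝ] G) {f : V → F} {y : V}
    (hf : DifferentiableAt ℝ f y) (u : V) :
    fderiv ℝ (fun z => S (f z)) y u = S (fderiv ℝ f y u) :=
  fderiv_clm_apply_comp (LinearMap.toContinuousLinearMap S) hf u

/-! ### Schouten brackets evaluated on covectors -/

section FlatSchouten

open Topology

variable {V : Type*} [NormedAddCommGroup V] [NormedSpace ℝ V] [FiniteDimensional ℝ V]
variable {A : Type*} [NormedAddCommGroup A] [NormedSpace ℝ A] [FiniteDimensional ℝ A]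

omit [FiniteDimensional ℝ A] in
theorem sum_coord_mul_apply {k : ℕ} (D : V →L[ℝ] Form k A) (w : V) (v : Fin k → A) :
    ∑ i, (Module.finBasis ℝ V).coord i w * D (Module.finBasis ℝ V i) v = D w v := by
  conv_rhs => rw [← (Module.finBasis ℝ V).sum_repr w]
  rw [map_sum, ContinuousAlternatingMap.sum_apply]
  refine Finset.sum_congr rfl fun i _ => ?_
  rw [map_smul]
  rfl

/-- The sign appears because `ε` fills the first slot here and the second one in `ε(P^#ζ) = P(ζ,
ε)`. -/
theorem intProd_bivector (P : MultiVec 2 A) (ε ζ : A →L[ℝ] ℝ) :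
    intProd ε P ![ζ] = -ε (sharp P ζ) := by
  rw [apply_sharp, ← Form.swap P ε ζ]
  rfl

/-- For `P = Q` of degree 2 the two sums coincide and both enter with sign `-1`; the sign of
`intProd_bivector` turns `-2` into `2`. The anchor is left general so as to cover both `TM` and `TM
× ℝ`. -/
theorem schoutenFlat_self_apply (ρ : A →L[ℝ] V) (P : V → MultiVec 2 A) (y : V)
    (ζ₁ ζ₂ ζ₃ : A →L[ℝ] ℝ) :
    (schoutenFlat (p := 1) (q := 1) ρ P P y : MultiVec 3 A) ![ζ₁, ζ₂, ζ₃] =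
      2 * (fderiv ℝ P y (ρ (sharp (P y) ζ₁)) ![ζ₂, ζ₃]
        + fderiv ℝ P y (ρ (sharp (P y) ζ₂)) ![ζ₃, ζ₁]
        + fderiv ℝ P y (ρ (sharp (P y) ζ₃)) ![ζ₁, ζ₂]) := by
  let b := Module.finBasis ℝ V
  let e : Fin (Module.finrank ℝ V) → (A →L[ℝ] ℝ) :=
    fun i => (LinearMap.toContinuousLinearMap (b.coord i)).comp ρ
  have h : (∑ i, wedge (intProd (e i) (P y)) (fderiv ℝ P y (b i)) : MultiVec 3 A) ![ζ₁, ζ₂, ζ₃] =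
      -(fderiv ℝ P y (ρ (sharp (P y) ζ₁)) ![ζ₂, ζ₃]
        + fderiv ℝ P y (ρ (sharp (P y) ζ₂)) ![ζ₃, ζ₁]
        + fderiv ℝ P y (ρ (sharp (P y) ζ₃)) ![ζ₁, ζ₂]) := by
    rw [ContinuousAlternatingMap.sum_apply]
    rw [← sum_coord_mul_apply (fderiv ℝ P y) (ρ (sharp (P y) ζ₁)),
      ← sum_coord_mul_apply (fderiv ℝ P y) (ρ (sharp (P y) ζ₂)),
      ← sum_coord_mul_apply (fderiv ℝ P y) (ρ (sharp (P y) ζ₃)),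
      ← Finset.sum_add_distrib, ← Finset.sum_add_distrib, ← Finset.sum_neg_distrib]
    refine Finset.sum_congr rfl fun i _ => ?_
    refine (wedge_one_two _ _ _ _ _).trans ?_
    rw [intProd_bivector, intProd_bivector, intProd_bivector]
    change -(b.coord i (ρ _)) * _ + -(b.coord i (ρ _)) * _ + -(b.coord i (ρ _)) * _ = _
    ring
  -- Both degrees reduce to `3`, so `castDeg` disappears by computation.
  have h' : ∀ hk : 1 + (1 + 1) = 1 + 1 + 1,
      castDeg hk (∑ i, wedge (intProd (e i) (P y)) (fderiv ℝ P y (b i)))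
        (![ζ₁, ζ₂, ζ₃] : Fin 3 → _) = _ := fun _ => h
  change (-1 : ℝ) ^ 1 * castDeg _ (∑ i, wedge (intProd (e i) (P y)) (fderiv ℝ P y (b i)))
      (![ζ₁, ζ₂, ζ₃] : Fin 3 → _) -
    (-1 : ℝ) ^ (1 * 1 + 1) * castDeg _ (∑ i, wedge (intProd (e i) (P y)) (fderiv ℝ P y (b i)))
      (![ζ₁, ζ₂, ζ₃] : Fin 3 → _) = _
  rw [h']
  ring

omit [FiniteDimensional ℝ V] in
theorem vec_add (u v : V) : vec (u + v) = vec u + vec v :=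
  Form.ext_one fun α => map_add α u v

omit [FiniteDimensional ℝ V] in
theorem vec_smul (c : ℝ) (v : V) : vec (c • v) = c • vec v :=
  Form.ext_one fun α => map_smul α c v

/-- The map `w ↦ vec w`. -/
def vecₗ : V →ₗ[ℝ] MultiVec 1 V where
  toFun := vec
  map_add' := vec_add
  map_smul' := vec_smul

theorem fderiv_vec_apply {E : V → V} {y : V} (hE : DifferentiableAt ℝ E y) (u : V)
    (α : V →L[ℝ] ℝ) :
    fderiv ℝ (fun z => vec (E z)) y u ![α] = α (fderiv ℝ E y u) := by
  have := fderiv_linearMap_comp (G := MultiVec 1 V) vecₗ hE u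
  exact DFunLike.congr_fun this ![α]

theorem schoutenFlat_vec_apply {E : V → V} {L : V → MultiVec 2 V} {y : V}
    (hE : DifferentiableAt ℝ E y) (α β : V →L[ℝ] ℝ) :
    (schoutenFlat (p := 0) (q := 1) (ContinuousLinearMap.id ℝ V) (fun z => vec (E z)) L y :
        MultiVec 2 V) ![α, β] =
      fderiv ℝ L y (E y) ![α, β] - β (fderiv ℝ E y (sharp (L y) α))
        + α (fderiv ℝ E y (sharp (L y) β)) := by
  let b := Module.finBasis ℝ V
  let e : Fin (Module.finrank ℝ V) → (V →L[ℝ] ℝ) :=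
    fun i => (LinearMap.toContinuousLinearMap (b.coord i)).comp (ContinuousLinearMap.id ℝ V)
  have h1 : (∑ i, wedge (intProd (k := 0) (e i) (vec (E y))) (fderiv ℝ L y (b i)) :
      MultiVec (0 + 2) V) (![α, β] : Fin 2 → _) = fderiv ℝ L y (E y) ![α, β] := by
    rw [ContinuousAlternatingMap.sum_apply, ← sum_coord_mul_apply (fderiv ℝ L y) (E y)]
    refine Finset.sum_congr rfl fun i _ => ?_
    exact wedge_zero_two _ _ _ _
  have h2 : (∑ i, wedge (intProd (e i) (L y)) (fderiv ℝ (fun z => vec (E z)) y (b i)) :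
      MultiVec 2 V) ![α, β] = -β (fderiv ℝ E y (sharp (L y) α))
        + α (fderiv ℝ E y (sharp (L y) β)) := by
    rw [ContinuousAlternatingMap.sum_apply, ← fderiv_vec_apply hE, ← fderiv_vec_apply hE,
      ← sum_coord_mul_apply (fderiv ℝ (fun z => vec (E z)) y) (sharp (L y) α),
      ← sum_coord_mul_apply (fderiv ℝ (fun z => vec (E z)) y) (sharp (L y) β),
      ← Finset.sum_neg_distrib, ← Finset.sum_add_distrib]
    refine Finset.sum_congr rfl fun i _ => ?_
    refine (wedge_one_one _ _ _ _).trans ?_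
    rw [intProd_bivector, intProd_bivector]
    change -(b.coord i _) * _ - -(b.coord i _) * _ = _
    ring
  have h1' : ∀ hk : 0 + (1 + 1) = 0 + 1 + 1,
      castDeg hk (∑ i, wedge (intProd (k := 0) (e i) (vec (E y))) (fderiv ℝ L y (b i)))
        (![α, β] : Fin 2 → _) = _ := fun _ => h1
  have h2' : ∀ hk : 1 + (0 + 1) = 0 + 1 + 1,
      castDeg hk (∑ i, wedge (intProd (e i) (L y)) (fderiv ℝ (fun z => vec (E z)) y (b i)))
        (![α, β] : Fin 2 → _) = _ := fun _ => h2
  change (-1 : ℝ) ^ 0 *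
      castDeg _ (∑ i, wedge (intProd (k := 0) (e i) (vec (E y))) (fderiv ℝ L y (b i)))
        (![α, β] : Fin 2 → _) -
    (-1 : ℝ) ^ (0 * 1 + 1) *
      castDeg _ (∑ i, wedge (intProd (e i) (L y)) (fderiv ℝ (fun z => vec (E z)) y (b i)))
        (![α, β] : Fin 2 → _) = _
  rw [h1', h2']
  ring

end FlatSchouten

/-! ### The bivector `(Λ, E)` on `W × ℝ` -/

section PairAlgebra

variable {W : Type*} [AddCommGroup W] [Module ℝ W] [TopologicalSpace W]
  [IsTopologicalAddGroup W] [ContinuousSMul ℝ W]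

/-- The pointwise form of `pair`. -/
def pairAt (P : MultiVec 2 W) (E : W) : MultiVec 2 (W × ℝ) :=
  push (ContinuousLinearMap.inl ℝ W ℝ) P
    + wedge (vec ((0, 1) : W × ℝ)) (vec ((E, 0) : W × ℝ))

omit [IsTopologicalAddGroup W] [ContinuousSMul ℝ W] in
theorem covector_prod_apply (ζ : W × ℝ →L[ℝ] ℝ) (w : W) (c : ℝ) :
    ζ (w, c) = ζ.comp (ContinuousLinearMap.inl ℝ W ℝ) w + c * ζ (0, 1) := by
  have : ((w, c) : W × ℝ) = ContinuousLinearMap.inl ℝ W ℝ w + c • ((0, 1) : W × ℝ) := by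
    ext <;> simp
  rw [this, map_add, map_smul]
  rfl

omit [IsTopologicalAddGroup W] in
theorem pairAt_apply (P : MultiVec 2 W) (E : W) (ζ ξ : W × ℝ →L[ℝ] ℝ) :
    pairAt P E ![ζ, ξ] =
      P ![ζ.comp (ContinuousLinearMap.inl ℝ W ℝ), ξ.comp (ContinuousLinearMap.inl ℝ W ℝ)]
        + (ζ (0, 1) * ξ.comp (ContinuousLinearMap.inl ℝ W ℝ) E
          - ξ (0, 1) * ζ.comp (ContinuousLinearMap.inl ℝ W ℝ) E) := by
  have h := wedge_one_one (vec ((0, 1) : W × ℝ)) (vec ((E, 0) : W × ℝ)) ζ ξ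
  simp only [vec_apply, Matrix.cons_val_zero] at h
  change push _ P ![ζ, ξ] + wedge (vec ((0, 1) : W × ℝ)) (vec ((E, 0) : W × ℝ)) ![ζ, ξ] = _
  rw [h, push_apply, Form.two_eta]
  rfl

omit [IsTopologicalAddGroup W] in
-- The cocycle `(0, 1)` restricts to zero on `W`, so of `Λ + (0, 1) ∧ E` only `E` survives.
theorem intProd_snd_pairAt (P : MultiVec 2 W) (E : W) (ξ : W × ℝ →L[ℝ] ℝ) :
    intProd (ContinuousLinearMap.snd ℝ W ℝ) (pairAt P E) ![ξ] =
      ξ.comp (ContinuousLinearMap.inl ℝ W ℝ) E := by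
  refine (pairAt_apply P E _ ξ).trans ?_
  have h : (ContinuousLinearMap.snd ℝ W ℝ).comp (ContinuousLinearMap.inl ℝ W ℝ) = 0 := by
    ext; simp
  have h0 : ∀ α, P ![0, α] = 0 := fun α => P.map_coord_zero 0 rfl
  rw [h, h0]
  simp

variable [T2Space W] [FiniteDimensional ℝ W]

theorem sharp_pairAt (P : MultiVec 2 W) (E : W) (ζ : W × ℝ →L[ℝ] ℝ) :
    sharp (pairAt P E) ζ =
      (sharp P (ζ.comp (ContinuousLinearMap.inl ℝ W ℝ)) + ζ (0, 1) • E,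
        -ζ.comp (ContinuousLinearMap.inl ℝ W ℝ) E) := by
  refine sub_eq_zero.1 ((Module.forall_dual_apply_eq_zero_iff ℝ _).1 fun g => ?_)
  let ξ : W × ℝ →L[ℝ] ℝ := LinearMap.toContinuousLinearMap g
  change ξ _ = 0
  rw [map_sub, apply_sharp, pairAt_apply, covector_prod_apply ξ (_ + _), map_add, map_smul,
    apply_sharp, smul_eq_mul]
  ring

end PairAlgebra

section FlatPair

variable {V : Type*} [NormedAddCommGroup V] [NormedSpace ℝ V] [FiniteDimensional ℝ V]

/-- The linear map `(P, E) ↦ pairAt P E`. -/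
def pairₗ : MultiVec 2 V × V →ₗ[ℝ] MultiVec 2 (V × ℝ) where
  toFun q := pairAt q.1 q.2
  map_add' q r := Form.ext_two fun ζ ξ => by
    rw [ContinuousAlternatingMap.add_apply]
    simp only [pairAt_apply, map_add, Prod.fst_add, Prod.snd_add,
      ContinuousAlternatingMap.add_apply]
    ring
  map_smul' c q := Form.ext_two fun ζ ξ => by
    rw [ContinuousAlternatingMap.smul_apply]
    simp only [pairAt_apply, map_smul, Prod.smul_fst, Prod.smul_snd,
      ContinuousAlternatingMap.smul_apply, smul_eq_mul, RingHom.id_apply]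
    ring

theorem fderiv_pairAt {L : V → MultiVec 2 V} {E : V → V} {y : V}
    (hL : DifferentiableAt ℝ L y) (hE : DifferentiableAt ℝ E y) (u : V) :
    fderiv ℝ (fun z => pairAt (L z) (E z)) y u =
      pairAt (fderiv ℝ L y u) (fderiv ℝ E y u) := by
  have h := fderiv_linearMap_comp (F := MultiVec 2 V × V) (G := MultiVec 2 (V × ℝ)) pairₗ
    (hL.prodMk hE) u
  rw [DifferentiableAt.fderiv_prodMk hL hE] at h
  exact h

end FlatPair

/-! ### 3-forms on `W × ℝ` and the extensions of `Λ^#` -/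

section TripleForms

variable {W : Type*} [AddCommGroup W] [Module ℝ W] [TopologicalSpace W]

theorem Form.three_cycle (η : Form 3 W) (u v w : W) : η ![u, v, w] = η ![v, w, u] := by
  have h := η.toAlternatingMap.map_perm ![u, v, w] (finRotate 3)
  have h1 : (![u, v, w] ∘ finRotate 3) = ![v, w, u] := by
    funext i; fin_cases i <;> rfl
  have h2 : Equiv.Perm.sign (finRotate 3) = 1 := by decide
  rw [h2, _root_.one_smul] at h
  change η (![u, v, w] ∘ finRotate 3) = η ![u, v, w] at h
  rw [← h, h1]

/-- Terms containing `e` twice vanish. It is applied with `e = E`, the components of `(Λ, E)^#(α,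
f)` along `TM` being `Λ^#α + f E`. -/
theorem Form.three_expand (η : Form 3 W) (a b c e : W) (f g h : ℝ) :
    η ![a + f • e, b + g • e, c + h • e] =
      η ![a, b, c] + f * η ![b, c, e] + g * η ![c, a, e] + h * η ![a, b, e] := by
  have h1 : ∀ v w, η ![a + f • e, v, w] = η ![a, v, w] + f * η ![e, v, w] := by
    intro v w
    exact (η.vecCons_add ![v, w] a (f • e)).trans
      (congrArg (η ![a, v, w] + ·) (η.vecCons_smul ![v, w] f e))
  have h2 : ∀ u v w, η ![u, v, w] = intProd u η ![v, w] := fun _ _ _ => rfl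
  have h3 : ∀ v, η ![e, e, v] = 0 := fun v =>
    η.map_eq_zero_of_eq ![e, e, v] (i := 0) (j := 1) rfl (by decide)
  have h4 : ∀ v, η ![e, v, e] = 0 := fun v =>
    η.map_eq_zero_of_eq ![e, v, e] (i := 0) (j := 2) rfl (by decide)
  rw [h1, h2 a, h2 e, Form.two_add_left, Form.two_add_left, Form.two_add_right,
    Form.two_add_right, Form.two_add_right, Form.two_add_right]
  simp only [Form.two_smul_left, Form.two_smul_right, Form.self]
  rw [(intProd a η).swap e c]
  simp only [← h2, h3, h4]
  rw [η.three_cycle e b c, η.three_cycle c a e, h2 a e c, (intProd a η).swap e c, ← h2]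
  ring

/-- The pointwise form of `pairForm`. -/
def pairFormAt (η : Form 3 W) (ξ : Form 2 W) : Form 3 (W × ℝ) :=
  η.compContinuousLinearMap (ContinuousLinearMap.fst ℝ W ℝ)
    + wedge (p := 1) (q := 2)
        (ContinuousAlternatingMap.ofSubsingleton ℝ (W × ℝ) ℝ (0 : Fin 1)
          (ContinuousLinearMap.snd ℝ W ℝ))
        (ξ.compContinuousLinearMap (ContinuousLinearMap.fst ℝ W ℝ))

theorem pairFormAt_apply (η : Form 3 W) (ξ : Form 2 W) (u v w : W × ℝ) :
    pairFormAt η ξ ![u, v, w] = η ![u.1, v.1, w.1] +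
      (u.2 * ξ ![v.1, w.1] + v.2 * ξ ![w.1, u.1] + w.2 * ξ ![u.1, v.1]) := by
  have h1 : η.compContinuousLinearMap (ContinuousLinearMap.fst ℝ W ℝ) ![u, v, w] =
      η ![u.1, v.1, w.1] := Form.three_eta η _
  have h2 : ∀ u v : W × ℝ, ξ.compContinuousLinearMap (ContinuousLinearMap.fst ℝ W ℝ) ![u, v] =
      ξ ![u.1, v.1] := fun u v => Form.two_eta ξ _
  have h3 := wedge_one_two (ContinuousAlternatingMap.ofSubsingleton ℝ (W × ℝ) ℝ (0 : Fin 1)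
    (ContinuousLinearMap.snd ℝ W ℝ)) (ξ.compContinuousLinearMap (ContinuousLinearMap.fst ℝ W ℝ))
    u v w
  rw [h2, h2, h2] at h3
  rw [pairFormAt, ContinuousAlternatingMap.add_apply, h1]
  exact congrArg _ h3

theorem sharpForm_two_apply (S : (W →L[ℝ] ℝ) →L[ℝ] W) (η : Form 2 W) (α β : W →L[ℝ] ℝ) :
    sharpForm S η ![α, β] = η ![S α, S β] := by
  change (-1 : ℝ) ^ 2 * η _ = _
  rw [Form.two_eta η]
  simp

theorem sharpForm_three_apply (S : (W →L[ℝ] ℝ) →L[ℝ] W) (η : Form 3 W) (α β γ : W →L[ℝ] ℝ) :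
    sharpForm S η ![α, β, γ] = -η ![S α, S β, S γ] := by
  change (-1 : ℝ) ^ 3 * η _ = _
  rw [Form.three_eta η]
  change (-1 : ℝ) ^ 3 * η ![S α, S β, S γ] = _
  ring

theorem sharpTensorOne_one_apply (S : (W →L[ℝ] ℝ) →L[ℝ] W) (η : Form 2 W) (w : W)
    (α : W →L[ℝ] ℝ) : sharpTensorOne S η w ![α] = η ![S α, w] := by
  change (-1 : ℝ) ^ 2 * intProdLast w η _ = _
  rw [intProdLast_apply, Form.two_eta η]
  change (-1 : ℝ) ^ 2 * η ![S α, w] = _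
  ring

theorem sharpTensorOne_two_apply (S : (W →L[ℝ] ℝ) →L[ℝ] W) (η : Form 3 W) (w : W)
    (α β : W →L[ℝ] ℝ) : sharpTensorOne S η w ![α, β] = -η ![S α, S β, w] := by
  change (-1 : ℝ) ^ 3 * intProdLast w η _ = _
  rw [intProdLast_apply, Form.three_eta η]
  change (-1 : ℝ) ^ 3 * η ![S α, S β, w] = _
  ring

end TripleForms

/-! ### The twisted Jacobi equations in a vector space -/

section FlatEquations

open Topology

variable {V : Type*} [NormedAddCommGroup V] [NormedSpace ℝ V] [FiniteDimensional ℝ V]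
variable {θ : V → Form 1 V} {ω : V → Form 2 V} {L : V → MultiVec 2 V} {E : V → V} {y : V}

theorem twistedJacobi_flat_one
    (h : ∀ᶠ z in 𝓝 y, AssociatedAt (θ z) (extDeriv θ z + ω z) (L z) (E z))
    (hθ : ContDiffAt ℝ 2 θ y) (hω : DifferentiableAt ℝ ω y) (hL : DifferentiableAt ℝ L y)
    (hE : DifferentiableAt ℝ E y) :
    (schoutenFlat (p := 1) (q := 1) (ContinuousLinearMap.id ℝ V) L L y : MultiVec 3 V)
        + (2 : ℝ) • (wedge (vec (E y)) (L y) : MultiVec 3 V) =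
      (2 : ℝ) • (sharpForm (sharp (L y)) (extDeriv ω y) : MultiVec 3 V)
        + (2 : ℝ) • (wedge (sharpForm (sharp (L y)) (ω y)) (vec (E y)) : MultiVec 3 V) := by
  refine Form.ext_three fun α β γ => ?_
  have key := twisted_cyclic_identity h hθ hω hL hE α β γ
  have h1 := schoutenFlat_self_apply (ContinuousLinearMap.id ℝ V) L y α β γ
  have h2 := wedge_one_two (vec (E y)) (L y) α β γ
  have h3 := wedge_two_one (sharpForm (sharp (L y)) (ω y)) (vec (E y)) α β γ
  simp only [sharpForm_two_apply, vec_apply, Matrix.cons_val_zero,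
    ContinuousLinearMap.id_apply] at h1 h2 h3
  simp only [ContinuousAlternatingMap.add_apply, ContinuousAlternatingMap.smul_apply,
    sharpForm_three_apply, smul_eq_mul]
  -- The degrees `1 + 2` and `2 + 1` equal `3` only after reduction, so the wedge formulas are
  -- inserted up to definitional equality.
  refine Eq.trans (congrArg₂ (fun s t => s + 2 * t) h1 h2) ?_
  refine Eq.trans ?_ (congrArg (fun t => 2 * -extDeriv ω y _ + 2 * t) h3.symm)
  linear_combination 2 * key

theorem twistedJacobi_flat_two
    (h : ∀ᶠ z in 𝓝 y, AssociatedAt (θ z) (extDeriv θ z + ω z) (L z) (E z))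
    (hθ : ContDiffAt ℝ 2 θ y) (hω : DifferentiableAt ℝ ω y) (hL : DifferentiableAt ℝ L y)
    (hE : DifferentiableAt ℝ E y) :
    (schoutenFlat (p := 0) (q := 1) (ContinuousLinearMap.id ℝ V) (fun z => vec (E z)) L y :
        MultiVec 2 V) =
      (sharpTensorOne (sharp (L y)) (extDeriv ω y) (E y) : MultiVec 2 V)
        - (wedge (sharpTensorOne (sharp (L y)) (ω y) (E y)) (vec (E y)) : MultiVec 2 V) := by
  refine Form.ext_two fun α β => ?_
  have key := twisted_lie_identity h hθ hω hL hE α β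
  have h3 := wedge_one_one (sharpTensorOne (sharp (L y)) (ω y) (E y)) (vec (E y)) α β
  simp only [sharpTensorOne_one_apply, vec_apply, Matrix.cons_val_zero] at h3
  rw [schoutenFlat_vec_apply hE, key, ContinuousAlternatingMap.sub_apply,
    sharpTensorOne_two_apply]
  refine Eq.trans ?_ (congrArg (fun t => -extDeriv ω y _ - t) h3.symm)
  ring

theorem twistedJacobi_flat_pair
    (h : ∀ᶠ z in 𝓝 y, AssociatedAt (θ z) (extDeriv θ z + ω z) (L z) (E z))
    (hθ : ContDiffAt ℝ 2 θ y) (hω : DifferentiableAt ℝ ω y) (hL : DifferentiableAt ℝ L y)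
    (hE : DifferentiableAt ℝ E y) {P : V → MultiVec 2 (V × ℝ)}
    (hP : P = fun z => pairAt (L z) (E z))
    (h1 : 1 + 1 + 1 = 3) (h2 : 1 + (1 + 1) = 3) :
    (2⁻¹ : ℝ) • ((schoutenFlat (p := 1) (q := 1) (ContinuousLinearMap.fst ℝ V ℝ) P P y :
          MultiVec 3 (V × ℝ))
        + ((1 : ℕ) : ℝ) • (castDeg h1
          (wedge (P y) (intProd (ContinuousLinearMap.snd ℝ V ℝ) (P y))) : MultiVec 3 (V × ℝ))
        + ((-1 : ℝ) ^ (1 + 1) * ((1 : ℕ) : ℝ)) • (castDeg h2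
          (wedge (intProd (ContinuousLinearMap.snd ℝ V ℝ) (P y)) (P y)) : MultiVec 3 (V × ℝ))) =
      sharpForm (sharp (P y)) (pairFormAt (extDeriv ω y) (ω y)) := by
  refine Form.ext_three fun ζ₁ ζ₂ ζ₃ => ?_
  have k1 := schoutenFlat_self_apply (ContinuousLinearMap.fst ℝ V ℝ) P y ζ₁ ζ₂ ζ₃
  have k2 : castDeg h1 (wedge (P y) (intProd (ContinuousLinearMap.snd ℝ V ℝ) (P y)))
      ![ζ₁, ζ₂, ζ₃] = _ := wedge_two_one _ _ ζ₁ ζ₂ ζ₃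
  have k3 : castDeg h2 (wedge (intProd (ContinuousLinearMap.snd ℝ V ℝ) (P y)) (P y))
      ![ζ₁, ζ₂, ζ₃] = _ := wedge_one_two _ _ ζ₁ ζ₂ ζ₃
  subst hP
  simp only [ContinuousAlternatingMap.add_apply, ContinuousAlternatingMap.smul_apply,
    smul_eq_mul]
  rw [k1, k2, k3, sharpForm_three_apply, pairFormAt_apply]
  simp only [sharp_pairAt, ContinuousLinearMap.coe_fst', intProd_snd_pairAt,
    fderiv_pairAt hL hE, pairAt_apply, Form.three_expand, map_add, map_smul,
    Form.two_add_left, Form.two_add_right, Form.two_smul_left, Form.two_smul_right, Form.self,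
    ContinuousAlternatingMap.add_apply, ContinuousAlternatingMap.smul_apply, smul_eq_mul]
  generalize ζ₁.comp (ContinuousLinearMap.inl ℝ V ℝ) = α
  generalize ζ₂.comp (ContinuousLinearMap.inl ℝ V ℝ) = β
  generalize ζ₃.comp (ContinuousLinearMap.inl ℝ V ℝ) = γ
  have e1 := twisted_cyclic_identity h hθ hω hL hE α β γ
  have e2 := twisted_lie_identity h hθ hω hL hE
  rw [(ω y).swap (E y), (ω y).swap (E y), (ω y).swap (E y)]
  push_cast
  -- Products of two of the components `ζᵢ(0, 1)` cancel by skewness. The part free of them is the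
  -- cyclic identity, and the coefficient of each is a Lie identity in the other two covectors.
  linear_combination e1 + ζ₁ (0, 1) * e2 β γ + ζ₂ (0, 1) * e2 γ α + ζ₃ (0, 1) * e2 α β

end FlatEquations

/-! ### Smoothness of `E` and `Λ` in a vector space -/

section FlatSmoothness

variable {V : Type*} [NormedAddCommGroup V] [NormedSpace ℝ V] [FiniteDimensional ℝ V]

theorem AssociatedAt.reeb_eq {θ : Form 1 V} {Ω : Form 2 V} {L : MultiVec 2 V} {E : V}
    (h : AssociatedAt θ Ω L E) : E = (contactMap θ Ω).inverse θ.covec := by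
  have h1 : contactMap θ Ω E = θ.covec := by
    ext v
    rw [contactMap_apply, h.reeb_two, h.reeb_one, Form.covec_apply, zero_add, one_mul]
  obtain ⟨e, he⟩ := h.nondeg.isInvertible
  rw [← h1, ← he, ContinuousLinearMap.inverse_equiv]
  exact (e.symm_apply_apply E).symm

theorem AssociatedAt.bivector_eq {θ : Form 1 V} {Ω : Form 2 V} {L : MultiVec 2 V} {E : V}
    (h : AssociatedAt θ Ω L E) (α β : V →L[ℝ] ℝ) :
    L ![α, β] = α E * β E - β ((contactMap θ Ω).inverse α) := by
  -- `Λ^# = E ⊗ E - B⁻¹`, read as a formula for the preimage of `α` under `B = contactMap θ Ω`.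
  have h1 : contactMap θ Ω (α E • E - sharp L α) = α := by
    ext v
    rw [map_sub, map_smul]
    change α E * contactMap θ Ω E v - contactMap θ Ω (sharp L α) v = α v
    rw [contactMap_apply, contactMap_apply, h.reeb_two, h.reeb_one, h.theta_sharp, h.sharp_two]
    ring
  obtain ⟨e, he⟩ := h.nondeg.isInvertible
  have h2 : (contactMap θ Ω).inverse α = α E • E - sharp L α := by
    conv_lhs => rw [← h1, ← he, ContinuousLinearMap.inverse_equiv]
    exact e.symm_apply_apply _
  rw [h2, map_sub, map_smul, apply_sharp, smul_eq_mul]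
  ring

theorem contDiffOn_associated {r : WithTop ℕ∞} {θ : V → Form 1 V} {Ω : V → Form 2 V}
    {L : V → MultiVec 2 V} {E : V → V} {s : Set V} (hθ : ContDiffOn ℝ r θ s)
    (hΩ : ContDiffOn ℝ r Ω s) (h : ∀ y ∈ s, AssociatedAt (θ y) (Ω y) (L y) (E y)) :
    ContDiffOn ℝ r E s ∧ ContDiffOn ℝ r L s := by
  have hθ1 : ∀ v : V, ContDiffOn ℝ r (fun y => θ y ![v]) s := fun v =>
    (ContinuousAlternatingMap.apply ℝ V ℝ ![v]).contDiff.comp_contDiffOn hθ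
  have hΩ1 : ∀ u v : V, ContDiffOn ℝ r (fun y => Ω y ![u, v]) s := fun u v =>
    (ContinuousAlternatingMap.apply ℝ V ℝ ![u, v]).contDiff.comp_contDiffOn hΩ
  have hB : ContDiffOn ℝ r (fun y => contactMap (θ y) (Ω y)) s := by
    refine contDiffOn_clm_apply.2 fun u => contDiffOn_clm_apply.2 fun v => ?_
    simp only [contactMap_apply]
    exact (hΩ1 u v).add ((hθ1 u).mul (hθ1 v))
  have hI : ContDiffOn ℝ r (fun y => (contactMap (θ y) (Ω y)).inverse) s := by
    intro y hy
    obtain ⟨e, he⟩ := (h y hy).nondeg.isInvertible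
    -- Inversion is smooth at each isomorphism, and the relations make `contactMap` one at every
    -- point of `s`.
    have := contDiffAt_map_inverse (n := r) e
    rw [he] at this
    exact this.comp_contDiffWithinAt y (hB y hy)
  have hc : ContDiffOn ℝ r (fun y => (θ y).covec) s := by
    refine contDiffOn_clm_apply.2 fun v => ?_
    simp only [Form.covec_apply]
    exact hθ1 v
  have hE : ContDiffOn ℝ r E s :=
    (hI.clm_apply hc).congr fun y hy => (h y hy).reeb_eq
  refine ⟨hE, contDiffOn_form_two fun α β => ?_⟩
  refine ContDiffOn.congr ?_ fun y hy => (h y hy).bivector_eq α β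
  exact ((α.contDiff.comp_contDiffOn hE).mul (β.contDiff.comp_contDiffOn hE)).sub
    (β.contDiff.comp_contDiffOn (hI.clm_apply contDiffOn_const))

omit [FiniteDimensional ℝ V] in
theorem contDiffOn_extDeriv {k : ℕ} {η : V → Form k V} {s : Set V} (hs : IsOpen s)
    (hη : ContDiffOn ℝ (⊤ : ℕ∞) η s) : ContDiffOn ℝ (⊤ : ℕ∞) (extDeriv η) s :=
  (ContinuousAlternatingMap.alternatizeUncurryFinCLM ℝ V ℝ).contDiff.comp_contDiffOn
    (hη.fderiv_of_isOpen hs (by simp))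

end FlatSmoothness

/-! ### Changes of charts and the exterior derivative -/

section Charts

open Topology

variable {V : Type*} [NormedAddCommGroup V] [NormedSpace ℝ V]
variable {M : Type*} [TopologicalSpace M] [ChartedSpace V M] [IsManifold 𝓘(ℝ, V) (⊤ : ℕ∞) M]

omit [IsManifold 𝓘(ℝ, V) (⊤ : ℕ∞) M] in
theorem isManifold_one [IsManifold 𝓘(ℝ, V) (⊤ : ℕ∞) M] : IsManifold 𝓘(ℝ, V) 1 M :=
  IsManifold.of_le (n := ((⊤ : ℕ∞) : WithTop ℕ∞)) (by norm_cast)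

theorem dChart_isInvertible {x₀ x : M} (hx : x ∈ (extChartAt 𝓘(ℝ, V) x₀).source) :
    (dChart V x₀ x).IsInvertible := by
  have := isManifold_one (V := V) (M := M)
  exact isInvertible_mfderiv_extChartAt hx

theorem dChart_dChartInv {x₀ x : M} (hx : x ∈ (extChartAt 𝓘(ℝ, V) x₀).source) (w : V) :
    dChart V x₀ x (dChartInv V x₀ x w) = w := by
  obtain ⟨e, he⟩ := dChart_isInvertible hx
  rw [dChartInv, ← he, ContinuousLinearMap.inverse_equiv]
  exact e.apply_symm_apply w

theorem dChartInv_dChart {x₀ x : M} (hx : x ∈ (extChartAt 𝓘(ℝ, V) x₀).source) (w : T V x) :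
    dChartInv V x₀ x (dChart V x₀ x w) = w := by
  obtain ⟨e, he⟩ := dChart_isInvertible hx
  rw [dChartInv, ← he, ContinuousLinearMap.inverse_equiv]
  exact e.symm_apply_apply w

/-- The tangent space at `x` is `V` itself, by way of the preferred chart at `x`. Operators defined
in that chart therefore agree at `x` with their flat versions. -/
theorem dChart_self (x : M) : dChart V x x = ContinuousLinearMap.id ℝ V := by
  have := isManifold_one (V := V) (M := M)
  exact mfderiv_extChartAt_self

theorem dChartInv_self (x : M) : dChartInv V x x = ContinuousLinearMap.id ℝ V := by
  ext w
  exact (dChartInv_dChart (mem_extChartAt_source x) w).symm.trans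
    (congrArg _ (DFunLike.congr_fun (dChart_self x) w)) |>.symm

theorem fderiv_transition {x₀ x₁ : M} {y : V} (hy : y ∈ (extChartAt 𝓘(ℝ, V) x₀).target)
    (hz : (extChartAt 𝓘(ℝ, V) x₀).symm y ∈ (extChartAt 𝓘(ℝ, V) x₁).source) :
    fderiv ℝ (extChartAt 𝓘(ℝ, V) x₁ ∘ (extChartAt 𝓘(ℝ, V) x₀).symm) y =
      (dChart V x₁ ((extChartAt 𝓘(ℝ, V) x₀).symm y)).comp
        (dChartInv V x₀ ((extChartAt 𝓘(ℝ, V) x₀).symm y)) := by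
  have := isManifold_one (V := V) (M := M)
  have h1 : MDifferentiableAt 𝓘(ℝ, V) 𝓘(ℝ, V) (extChartAt 𝓘(ℝ, V) x₀).symm y := by
    have := mdifferentiableWithinAt_extChartAt_symm hy
    rwa [ModelWithCorners.range_eq_univ, mdifferentiableWithinAt_univ] at this
  have h2 : MDifferentiableAt 𝓘(ℝ, V) 𝓘(ℝ, V) (extChartAt 𝓘(ℝ, V) x₁)
      ((extChartAt 𝓘(ℝ, V) x₀).symm y) :=
    mdifferentiableAt_extChartAt (by rwa [extChartAt_source] at hz)
  have h3 := mfderiv_extChartAt_comp_mfderivWithin_extChartAt_symm hy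
  have h4 := mfderivWithin_extChartAt_symm_comp_mfderiv_extChartAt hy
  rw [ModelWithCorners.range_eq_univ, mfderivWithin_univ] at h3 h4
  rw [← mfderiv_eq_fderiv, mfderiv_comp y h2 h1]
  have h5 : dChartInv V x₀ ((extChartAt 𝓘(ℝ, V) x₀).symm y) =
      mfderiv 𝓘(ℝ, V) 𝓘(ℝ, V) (extChartAt 𝓘(ℝ, V) x₀).symm y :=
    ContinuousLinearMap.inverse_eq h3 h4
  rw [h5]
  rfl

theorem contDiffAt_transition {x₀ x₁ : M} {y : V} (hy : y ∈ (extChartAt 𝓘(ℝ, V) x₀).target)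
    (hz : (extChartAt 𝓘(ℝ, V) x₀).symm y ∈ (extChartAt 𝓘(ℝ, V) x₁).source) :
    ContDiffAt ℝ (⊤ : ℕ∞) (extChartAt 𝓘(ℝ, V) x₁ ∘ (extChartAt 𝓘(ℝ, V) x₀).symm) y := by
  have h := contDiffWithinAt_ext_coord_change (I := 𝓘(ℝ, V)) (n := ((⊤ : ℕ∞) : WithTop ℕ∞))
    x₁ x₀ (y := y) (by
      rw [PartialEquiv.trans_source]
      exact ⟨hy, hz⟩)
  rwa [ModelWithCorners.range_eq_univ, contDiffWithinAt_univ] at h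

omit [IsManifold 𝓘(ℝ, V) (⊤ : ℕ∞) M] in
theorem eventually_transition {x₀ x₁ : M} {y : V} (hy : y ∈ (extChartAt 𝓘(ℝ, V) x₀).target)
    (hz : (extChartAt 𝓘(ℝ, V) x₀).symm y ∈ (extChartAt 𝓘(ℝ, V) x₁).source) :
    ∀ᶠ y' in 𝓝 y, y' ∈ (extChartAt 𝓘(ℝ, V) x₀).target ∧
      (extChartAt 𝓘(ℝ, V) x₀).symm y' ∈ (extChartAt 𝓘(ℝ, V) x₁).source := by
  have ho := isOpen_extChartAt_target (I := 𝓘(ℝ, V)) x₀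
  have hc := (continuousOn_extChartAt_symm (I := 𝓘(ℝ, V)) x₀).continuousAt (ho.mem_nhds hy)
  exact Filter.Eventually.and (ho.mem_nhds hy)
    (hc.preimage_mem_nhds ((isOpen_extChartAt_source x₁).mem_nhds hz))

omit [IsManifold 𝓘(ℝ, V) (⊤ : ℕ∞) M] in
theorem formInChart_apply {k : ℕ} (η : DiffForm V M k) {x₀ x : M}
    (hx : x ∈ (extChartAt 𝓘(ℝ, V) x₀).source) :
    formInChart η x₀ (extChartAt 𝓘(ℝ, V) x₀ x) =
      (η x).compContinuousLinearMap (dChartInv V x₀ x) :=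
  congrArg (fun w => (η w).compContinuousLinearMap (dChartInv V x₀ w))
    ((extChartAt 𝓘(ℝ, V) x₀).left_inv hx)

/-- At the point `z` over `y`, `extDer` uses the chart at `z` rather than at `x₀`; the two results
agree because `d` commutes with pullback along the transition map `τ`. -/
theorem formInChart_extDer {k : ℕ} {η : DiffForm V M k} (hη : SmoothForm η) (x₀ : M) {y : V}
    (hy : y ∈ (extChartAt 𝓘(ℝ, V) x₀).target) :
    formInChart (extDer η) x₀ y = extDeriv (formInChart η x₀) y := by
  set z := (extChartAt 𝓘(ℝ, V) x₀).symm y with hzdef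
  have hz : z ∈ (extChartAt 𝓘(ℝ, V) z).source := mem_extChartAt_source z
  set τ := extChartAt 𝓘(ℝ, V) z ∘ (extChartAt 𝓘(ℝ, V) x₀).symm with hτ
  have hev : formInChart η x₀ =ᶠ[𝓝 y]
      fun y' => (formInChart η z (τ y')).compContinuousLinearMap (fderiv ℝ τ y') := by
    filter_upwards [eventually_transition hy hz] with y' hy'
    rw [hτ, fderiv_transition hy'.1 hy'.2]
    rw [Function.comp_apply, formInChart_apply η hy'.2]
    ext v
    simp only [formInChart, ContinuousAlternatingMap.compContinuousLinearMap_apply]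
    congr 1
    funext i
    exact (dChartInv_dChart hy'.2 _).symm
  have hd : DifferentiableAt ℝ (formInChart η z) (τ y) :=
    ((hη z).contDiffAt ((isOpen_extChartAt_target z).mem_nhds
      ((extChartAt 𝓘(ℝ, V) z).map_source hz))).differentiableAt (by simp)
  rw [hev.extDeriv_eq, extDeriv_pullback hd (contDiffAt_transition hy hz)
    (by simpa using WithTop.coe_le_coe.2 (le_top : (2 : ℕ∞) ≤ ⊤)),
    fderiv_transition hy hz]
  rfl

theorem smoothVecField_of_chart {E : VecField V M}
    (h : ∀ x₀ : M, ContDiffOn ℝ (⊤ : ℕ∞)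
      (fun y => dChart V x₀ ((extChartAt 𝓘(ℝ, V) x₀).symm y)
        (E ((extChartAt 𝓘(ℝ, V) x₀).symm y))) (extChartAt 𝓘(ℝ, V) x₀).target) :
    SmoothVecField E := by
  have := isManifold_one (V := V) (M := M)
  intro x₀
  refine (Bundle.contMDiffAt_section x₀).2 ?_
  have h1 := (h x₀).contDiffAt ((isOpen_extChartAt_target x₀).mem_nhds (mem_extChartAt_target x₀))
  have h2 := (h1.contMDiffAt).comp x₀
    (contMDiffAt_extChartAt (I := 𝓘(ℝ, V)) (n := ((⊤ : ℕ∞) : WithTop ℕ∞)))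
  refine h2.congr_of_eventuallyEq ?_
  filter_upwards [extChartAt_source_mem_nhds (I := 𝓘(ℝ, V)) x₀] with x hx
  simp only [Function.comp_apply]
  rw [(extChartAt 𝓘(ℝ, V) x₀).left_inv hx]
  rw [extChartAt_source] at hx
  -- The trivialisation of the tangent bundle at `x₀` is, on fibres, the differential of the chart
  -- at `x₀`.
  have h3 := TangentBundle.continuousLinearMapAt_trivializationAt (I := 𝓘(ℝ, V)) hx
  refine Eq.trans ?_ (DFunLike.congr_fun h3 (E x))
  rw [Bundle.Trivialization.continuousLinearMapAt_apply,
    Bundle.Trivialization.linearMapAt_apply, if_pos]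
  simpa using hx

end Charts

/-! ### From pointwise relations to fields on `M` -/

section Main

open Topology

variable {V : Type*} [NormedAddCommGroup V] [NormedSpace ℝ V] [FiniteDimensional ℝ V]
variable {M : Type*} [TopologicalSpace M] [ChartedSpace V M]

theorem isAssociatedPair_iff {ϑ : DiffForm V M 1} {ω : DiffForm V M 2} {L : MultiVecField V M 2}
    {E : VecField V M} :
    IsAssociatedPair ϑ ω L E ↔ ∀ x, AssociatedAt (ϑ x) (extDer ϑ x + ω x) (L x) (E x) := by
  constructor
  · intro h x
    refine ⟨h.reeb_one x, fun v => ?_, h.sharp_one x, h.sharp_two x⟩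
    exact DFunLike.congr_fun (h.reeb_two x) ![v]
  · intro h
    refine ⟨fun x => (h x).reeb_one, fun x => ?_, fun x => (h x).sharp_one,
      fun x => (h x).sharp_two⟩
    refine Form.ext_one fun v => ?_
    exact (h x).reeb_two v

end Main

/-- A coordinate change acts trivially on the factor `ℝ`, so forming `(Λ, E)` commutes with passing
to a chart. -/
theorem push_pairAt {W W' : Type*} [AddCommGroup W] [Module ℝ W] [TopologicalSpace W]
    [ContinuousSMul ℝ W] [AddCommGroup W'] [Module ℝ W'] [TopologicalSpace W']
    [ContinuousSMul ℝ W'] (f : W →L[ℝ] W') (P : MultiVec 2 W) (E : W) :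
    push (f.prodMap (ContinuousLinearMap.id ℝ ℝ)) (pairAt P E) = pairAt (push f P) (f E) := by
  refine Form.ext_two fun ζ ξ => ?_
  have h1 : ∀ ζ : W' × ℝ →L[ℝ] ℝ, (ζ.comp (f.prodMap (ContinuousLinearMap.id ℝ ℝ))).comp
      (ContinuousLinearMap.inl ℝ W ℝ) = (ζ.comp (ContinuousLinearMap.inl ℝ W' ℝ)).comp f := by
    intro ζ
    ext w
    simp
  have h2 : ∀ ζ : W' × ℝ →L[ℝ] ℝ, ζ.comp (f.prodMap (ContinuousLinearMap.id ℝ ℝ)) (0, 1) =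
      ζ (0, 1) := by
    intro ζ
    simp
  have h3 : ∀ α β : W' →L[ℝ] ℝ, push f P ![α, β] = P ![α.comp f, β.comp f] := fun α β =>
    Form.two_eta P _
  have h4 : push (f.prodMap (ContinuousLinearMap.id ℝ ℝ)) (pairAt P E) ![ζ, ξ] =
      pairAt P E ![ζ.comp (f.prodMap (ContinuousLinearMap.id ℝ ℝ)),
        ξ.comp (f.prodMap (ContinuousLinearMap.id ℝ ℝ))] := Form.two_eta (pairAt P E) _
  rw [h4, pairAt_apply, pairAt_apply, h1, h1, h2, h2, h3]
  rfl

/-! ### Globalisation through the charts -/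

section Global

open Topology

variable {V : Type*} [NormedAddCommGroup V] [NormedSpace ℝ V] [FiniteDimensional ℝ V]
variable {M : Type*} [TopologicalSpace M] [ChartedSpace V M]

/-- The expression of a vector field in the preferred chart at `x₀`. -/
def vecInChart (E : VecField V M) (x₀ : M) (y : V) : V :=
  dChart V x₀ ((extChartAt 𝓘(ℝ, V) x₀).symm y) (E ((extChartAt 𝓘(ℝ, V) x₀).symm y))

theorem pairSharp_eq (L : MultiVecField V M 2) (E : VecField V M) (x : M) :
    pairSharp L E x = sharp (pairAt (L x) (E x)) := by
  refine ContinuousLinearMap.ext fun ζ => ?_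
  rw [sharp_pairAt]
  rfl

omit [FiniteDimensional ℝ V] in
theorem multiVecRInChart_pair (L : MultiVecField V M 2) (E : VecField V M) (x₀ : M) :
    multiVecRInChart (pair L E) x₀ =
      fun y => pairAt (multiVecInChart L x₀ y) (vecInChart E x₀ y) := by
  funext y
  exact push_pairAt _ _ _

variable [IsManifold 𝓘(ℝ, V) (⊤ : ℕ∞) M]

omit [FiniteDimensional ℝ V] in
theorem multiVecInChart_self {k : ℕ} (P : MultiVecField V M k) (x : M) :
    multiVecInChart P x (extChartAt 𝓘(ℝ, V) x x) = P x := by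
  have h : multiVecInChart P x (extChartAt 𝓘(ℝ, V) x x) = push (dChart V x x) (P x) :=
    congrArg (fun w => push (dChart V x w) (P w))
      ((extChartAt 𝓘(ℝ, V) x).left_inv (mem_extChartAt_source x))
  rw [h, dChart_self]
  rfl

omit [FiniteDimensional ℝ V] in
theorem vecInChart_self (E : VecField V M) (x : M) :
    vecInChart E x (extChartAt 𝓘(ℝ, V) x x) = E x := by
  have h : vecInChart E x (extChartAt 𝓘(ℝ, V) x x) = dChart V x x (E x) :=
    congrArg (fun w => dChart V x w (E w))
      ((extChartAt 𝓘(ℝ, V) x).left_inv (mem_extChartAt_source x))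
  rw [h, dChart_self]
  rfl

omit [FiniteDimensional ℝ V] in
theorem formInChart_self {k : ℕ} (η : DiffForm V M k) (x : M) :
    formInChart η x (extChartAt 𝓘(ℝ, V) x x) = η x := by
  rw [formInChart_apply η (mem_extChartAt_source x), dChartInv_self]
  rfl

omit [FiniteDimensional ℝ V] in
theorem extDer_eq {k : ℕ} (η : DiffForm V M k) (x : M) :
    extDer η x = extDeriv (formInChart η x) (extChartAt 𝓘(ℝ, V) x x) := by
  rw [extDer, dChart_self]
  rfl

theorem schouten_eq {p q : ℕ} (P : MultiVecField V M (p + 1)) (Q : MultiVecField V M (q + 1))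
    (x : M) : schouten P Q x = schoutenFlat (ContinuousLinearMap.id ℝ V)
      (multiVecInChart P x) (multiVecInChart Q x) (extChartAt 𝓘(ℝ, V) x x) := by
  rw [schouten, dChartInv_self]
  rfl

theorem schoutenR_eq {p q : ℕ} (P : MultiVecFieldR V M (p + 1)) (Q : MultiVecFieldR V M (q + 1))
    (x : M) : schoutenR P Q x = schoutenFlat (ContinuousLinearMap.fst ℝ V ℝ)
      (multiVecRInChart P x) (multiVecRInChart Q x) (extChartAt 𝓘(ℝ, V) x x) := by
  rw [schoutenR, dChartInv_self]
  rfl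

theorem associatedAt_chart {ϑ : DiffForm V M 1} {ω : DiffForm V M 2} {L : MultiVecField V M 2}
    {E : VecField V M} (hϑ : SmoothForm ϑ)
    (h : ∀ x, AssociatedAt (ϑ x) (extDer ϑ x + ω x) (L x) (E x)) (x₀ : M) {y : V}
    (hy : y ∈ (extChartAt 𝓘(ℝ, V) x₀).target) :
    AssociatedAt (formInChart ϑ x₀ y) (extDeriv (formInChart ϑ x₀) y + formInChart ω x₀ y)
      (multiVecInChart L x₀ y) (vecInChart E x₀ y) := by
  rw [← formInChart_extDer hϑ x₀ hy]
  have hx := (extChartAt 𝓘(ℝ, V) x₀).map_target hy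
  exact (h ((extChartAt 𝓘(ℝ, V) x₀).symm y)).map _ _ (dChart_dChartInv hx) (dChartInv_dChart hx)

theorem smooth_associated {ϑ : DiffForm V M 1} {ω : DiffForm V M 2} {L : MultiVecField V M 2}
    {E : VecField V M} (hϑ : SmoothForm ϑ) (hω : SmoothForm ω)
    (h : ∀ x, AssociatedAt (ϑ x) (extDer ϑ x + ω x) (L x) (E x)) (x₀ : M) :
    ContDiffOn ℝ (⊤ : ℕ∞) (vecInChart E x₀) (extChartAt 𝓘(ℝ, V) x₀).target ∧
      ContDiffOn ℝ (⊤ : ℕ∞) (multiVecInChart L x₀) (extChartAt 𝓘(ℝ, V) x₀).target :=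
  contDiffOn_associated (hϑ x₀)
    ((contDiffOn_extDeriv (isOpen_extChartAt_target x₀) (hϑ x₀)).add (hω x₀))
    fun _ hy => associatedAt_chart hϑ h x₀ hy

theorem twistedJacobi_of_associatedAt {ϑ : DiffForm V M 1} {ω : DiffForm V M 2}
    {L : MultiVecField V M 2} {E : VecField V M} (hϑ : SmoothForm ϑ) (hω : SmoothForm ω)
    (h : ∀ x, AssociatedAt (ϑ x) (extDer ϑ x + ω x) (L x) (E x)) :
    TwistedJacobiEq₁ L E ω ∧ TwistedJacobiEq₂ L E ω ∧ IsTwistedJacobi L E ω := by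
  have hn := fun x : M =>
    (isOpen_extChartAt_target (I := 𝓘(ℝ, V)) x).mem_nhds (mem_extChartAt_target x)
  have hs := smooth_associated hϑ hω h
  -- The relations hold on the whole chart domain, not only at its centre, and so may be
  -- differentiated there.
  have hA := fun x => Filter.eventually_of_mem (hn x) fun y hy => associatedAt_chart hϑ h x hy
  have h2 : (2 : WithTop ℕ∞) ≤ ((⊤ : ℕ∞) : WithTop ℕ∞) :=
    WithTop.coe_le_coe.2 (le_top : (2 : ℕ∞) ≤ ⊤)
  have hϑ' := fun x => ((hϑ x).contDiffAt (hn x)).of_le h2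
  have hω' := fun x => ((hω x).contDiffAt (hn x)).differentiableAt (by simp)
  have hE := fun x => ((hs x).1.contDiffAt (hn x)).differentiableAt (by simp)
  have hL := fun x => ((hs x).2.contDiffAt (hn x)).differentiableAt (by simp)
  refine ⟨fun x => ?_, fun x => ?_, fun x => (hs x).2,
    smoothVecField_of_chart fun x => (hs x).1, hω, fun x => ?_⟩
  · have key := twistedJacobi_flat_one (hA x) (hϑ' x) (hω' x) (hL x) (hE x)
    rw [← schouten_eq, ← extDer_eq, multiVecInChart_self, vecInChart_self,
      formInChart_self] at key
    exact key
  · have key := twistedJacobi_flat_two (hA x) (hϑ' x) (hω' x) (hL x) (hE x)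
    rw [← extDer_eq, multiVecInChart_self, vecInChart_self, formInChart_self] at key
    exact (schouten_eq (p := 0) (q := 1) (fun z => vec (E z)) L x).trans key
  · have key := twistedJacobi_flat_pair (hA x) (hϑ' x) (hω' x) (hL x) (hE x)
      (multiVecRInChart_pair L E x) rfl rfl
    have hp : multiVecRInChart (pair L E) x (extChartAt 𝓘(ℝ, V) x x) = pairAt (L x) (E x) := by
      rw [← multiVecInChart_self L x, ← vecInChart_self E x]
      exact congrFun (multiVecRInChart_pair L E x) _
    rw [← schoutenR_eq, ← extDer_eq, hp, formInChart_self] at key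
    rw [pairSharp_eq]
    exact key

end Global

end TwistedJacobi

end

open TwistedJacobi
theorem mainTheorem3
    {V : Type*} [NormedAddCommGroup V] [NormedSpace ℝ V] [FiniteDimensional ℝ V]
    {M : Type*} [TopologicalSpace M] [ChartedSpace V M] [IsManifold 𝓘(ℝ, V) (⊤ : ℕ∞) M]
    (n : ℕ) (ϑ : DiffForm V M 1) (ω : DiffForm V M 2) (h : IsTwistedContact n ϑ ω) :
    ∃ (L : MultiVecField V M 2) (E : VecField V M),
      IsAssociatedPair ϑ ω L E ∧
      (∀ (L' : MultiVecField V M 2) (E' : VecField V M),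
        IsAssociatedPair ϑ ω L' E' → L' = L ∧ E' = E) ∧
      SmoothMultiVecField L ∧ SmoothVecField E ∧
      TwistedJacobiEq₁ L E ω ∧ TwistedJacobiEq₂ L E ω ∧
      IsTwistedJacobi L E ω := by
  have hA : ∀ x : M, AssociatedAt (ϑ x) (extDer ϑ x + ω x)
      (contactBivec (ϑ x) (extDer ϑ x + ω x)) (reeb (ϑ x) (extDer ϑ x + ω x)) := fun x =>
    have hW : Module.finrank ℝ (T V x) = 2 * n + 1 := h.finrank_eq
    -- The dimension enters twice: `ϑ ∧ Ωⁿ` has top degree, and oddness gives `Ω` a kernel.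
    (nondeg_of_wedge_ne_zero hW (h.nonvanishing x)).associatedAt hW
  obtain ⟨h1, h2, h3⟩ := twistedJacobi_of_associatedAt h.smooth_one h.smooth_two hA
  refine ⟨_, _, isAssociatedPair_iff.2 hA, fun L' E' h' => ?_, h3.smooth_bivector,
    h3.smooth_vector, h1, h2, h3⟩
  have hu := fun x => (isAssociatedPair_iff.1 h' x).unique (hA x)
  exact ⟨funext fun x => (hu x).1, funext fun x => (hu x).2⟩
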